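/- Fix a finite set $A$ of monadic predicate symbols. The formulas of $\mathrm{FOE}^\infty(A)$ are given by $$\varphi ::= \top \mid \bot \mid a(x) \mid \neg a(x) \mid x\approx y \mid x\not\approx y \mid \varphi\lor\varphi \mid \varphi\land\varphi \mid \exists x.\varphi \mid \forall x.\varphi \mid \exists^\infty x.\varphi \mid \forall^\infty x.\varphi ,$$ where $a\in A$ and $x,y$ range over a countably infinite set of variables. They are interpreted in models $(D,V)$ with a (possibly empty) set $D$ and $V:A\to\wp(D)$; $\exists^\infty$ means "for infinitely many" and $\forall^\infty$ means "for all but finitely many". Two sentences are equivalent if they are true in the same models (including the empty model, where every $\exists x.\varphi$ and $\exists^\infty x.\varphi$ is false and every $\forall x.\varphi$ and $\forall^\infty x.\varphi$ is true). A formula is positive if it has no subformula $\neg a(x)$. Let $B\subseteq A$. For valuations $U,V$ on the same $D$ write $U\le_B V$ if $U(b)\subseteq V(b)$ for all $b\in B$ and $U(a)=V(a)$ for all $a\in A\setminus B$. A formula $\varphi$ is monotone in $B$ if $(D,U),g\models\varphi$ and $U\le_B V$ imply $(D,V),g\models\varphi$; it is continuous in $B$ if it is monotone in $B$ and whenever $(D,V),g\models\varphi$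 there is $U\le_B V$ with $U(b)$ finite for all $b\in B$ and $(D,U),g\models\varphi$. For $C,S\subseteq A$ let $\tau^C_S(x):=\bigwedge_{a\in S}a(x)\land\bigwedge_{a\in A\setminus(S\cup C)}\neg a(x)$. For a finite list $\mathbf T=T_1\cdots T_n$ of subsets of $A$ and sets $\Pi,\Sigma\subseteq\wp(A)$ let $$\nabla^C(\mathbf T,\Pi,\Sigma):=\exists x_1\cdots x_n.\Big(\mathrm{diff}(x_1,\dots,x_n)\land\bigwedge_{i}\tau^C_{T_i}(x_i)\land\forall z.\big(\mathrm{diff}(x_1,\dots,x_n,z)\to\bigvee_{S\in\Pi\cup\Sigma}\tau^C_S(z)\big)\Big)\land\bigwedge_{S\in\Sigma}\exists^\infty y.\tau^C_S(y)\land\forall^\infty y.\bigvee_{S\in\Sigma}\tau^C_S(y),$$ where $\mathrm{diff}(y_1,\dots,y_m)$ says that $y_1,\dots,y_m$ are pairwise distinct ($\mathrm{diff}(\mathbf y)\to\psi$ abbreviates $\bigvee_{i<j}y_i\approx y_j\lor\psi$). For $C=A$ it is called fully positive. Then for every $B\subseteq A$: 1. A sentence $\varphi$ of $\mathrm{FOE}^\infty(A)$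 is continuous in $B$ if and only if it is equivalent to a finite disjunction of formulas $\nabla^B(\mathbf T,\Pi,\Sigma)$ with $\Sigma\subseteq\Pi\subseteq\{T_1,\dots,T_n\}$ and $B\cap\bigcup\Sigma=\varnothing$. Moreover, such a disjunction is effectively obtainable from $\varphi$: there is a computable map $f$ on formulas such that for every sentence $\varphi$, $f(\varphi)$ is a disjunction of this form, and $\varphi$ is continuous in $B$ if and only if $\varphi$ is equivalent to $f(\varphi)$. 2. If a sentence $\varphi$ is monotone in $A$ (for example, positive), then it is continuous in $B$ if and only if it is equivalent to a finite disjunction of fully positive formulas $\nabla^A(\mathbf T,\Pi,\Sigma)$ with $\Sigma\subseteq\Pi\subseteq\{T_1,\dots,T_n\}$ and $B\cap\bigcup\Sigma=\varnothing$. Moreover, there is a computable map $f$ on formulas such that for every sentence $\varphi$ that is monotone in $A$, $f(\varphi)$ is a disjunction of this form, and $\varphi$ is continuous in $B$ if and only if $\varphi$ is equivalent to $f(\varphi)$. -/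

import Mathlib

universe u v

namespace Monadic

/-- Formulas of monadic logic with equality and the quantifiers "there are infinitely many" and
"for all but finitely many", in negation normal form, over the set `A` of predicate names.
The individual variables are the natural numbers. -/
inductive Formula (A : Type v) : Type v
  | top : Formula A
  | bot : Formula A
  | pred (a : A) (x : ℕ) : Formula A
  | npred (a : A) (x : ℕ) : Formula A
  | eq (x y : ℕ) : Formula A
  | neq (x y : ℕ) : Formula A
  | or (φ ψ : Formula A) : Formula A
  | and (φ ψ : Formula A) : Formula A
  | ex (x : ℕ) (φ : Formula A) : Formula A
  | all (x : ℕ) (φ : Formula A) : Formula A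
  | exInf (x : ℕ) (φ : Formula A) : Formula A
  | allInf (x : ℕ) (φ : Formula A) : Formula A

namespace Formula

variable {A : Type v}

/-! ### Free variables, sentences, positive formulas -/

/-- The free variables of a formula. -/
def freeVars : Formula A → Finset ℕ
  | top => ∅
  | bot => ∅
  | pred _ x => {x}
  | npred _ x => {x}
  | eq x y => {x, y}
  | neq x y => {x, y}
  | or φ ψ => φ.freeVars ∪ ψ.freeVars
  | and φ ψ => φ.freeVars ∪ ψ.freeVars
  | ex x φ => φ.freeVars.erase x
  | all x φ => φ.freeVars.erase x
  | exInf x φ => φ.freeVars.erase x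
  | allInf x φ => φ.freeVars.erase x

/-- A sentence is a formula without free variables. -/
def IsSentence (φ : Formula A) : Prop := φ.freeVars = ∅

/-- The positive fragment: no negated predicates `¬ a(x)`. -/
def IsPositive : Formula A → Prop
  | top => True
  | bot => True
  | pred _ _ => True
  | npred _ _ => False
  | eq _ _ => True
  | neq _ _ => True
  | or φ ψ => φ.IsPositive ∧ ψ.IsPositive
  | and φ ψ => φ.IsPositive ∧ ψ.IsPositive
  | ex _ φ => φ.IsPositive
  | all _ φ => φ.IsPositive
  | exInf _ φ => φ.IsPositive
  | allInf _ φ => φ.IsPositive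

/-! ### Semantics

A monadic model is a (possibly empty) domain `D` with a valuation `V : A → Set D`. -/

/-- Truth of a formula in the model `(D, V)` under the assignment `g`. (An assignment exists only
when the domain is nonempty.) -/
def Holds {D : Type u} (V : A → Set D) : (ℕ → D) → Formula A → Prop
  | _, top => True
  | _, bot => False
  | g, pred a x => g x ∈ V a
  | g, npred a x => g x ∉ V a
  | g, eq x y => g x = g y
  | g, neq x y => g x ≠ g y
  | g, or φ ψ => Holds V g φ ∨ Holds V g ψ
  | g, and φ ψ => Holds V g φ ∧ Holds V g ψ
  | g, ex x φ => ∃ d : D, Holds V (Function.update g x d) φ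
  | g, all x φ => ∀ d : D, Holds V (Function.update g x d) φ
  | g, exInf x φ => {d : D | Holds V (Function.update g x d) φ}.Infinite
  | g, allInf x φ => {d : D | ¬ Holds V (Function.update g x d) φ}.Finite

/-- Truth of a sentence in the empty model. Literals get a dummy value: in a sentence they occur
only below quantifiers, whose value does not depend on what is below them. -/
def HoldsEmpty : Formula A → Prop
  | top => True
  | bot => False
  | pred _ _ => False
  | npred _ _ => False
  | eq _ _ => False
  | neq _ _ => False
  | or φ ψ => φ.HoldsEmpty ∨ ψ.HoldsEmpty
  | and φ ψ => φ.HoldsEmpty ∧ ψ.HoldsEmpty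
  | ex _ _ => False
  | all _ _ => True
  | exInf _ _ => False
  | allInf _ _ => True

/-- Truth of a sentence in the model `(D, V)`. -/
def Models {D : Type u} (V : A → Set D) (φ : Formula A) : Prop :=
  (IsEmpty D ∧ φ.HoldsEmpty) ∨ (Nonempty D ∧ ∀ g : ℕ → D, Holds V g φ)

/-- Two sentences are equivalent if they are true in the same models (with domain in `Type u`),
the empty model included. -/
def Equivalent (φ ψ : Formula A) : Prop :=
  ∀ (D : Type u) (V : A → Set D), Models V φ ↔ Models V ψ

/-! ### Monotonicity and continuity -/

/-- `V ≤_B V'`: the valuation `V'` is a `B`-extension of `V`. -/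
def BExtends (B : Finset A) {D : Type u} (V V' : A → Set D) : Prop :=
  (∀ b ∈ B, V b ⊆ V' b) ∧ ∀ a ∉ B, V a = V' a

/-- Monotonicity in `B`. (On an empty domain there is just one valuation, so nothing is
required there.) -/
def IsMonotoneIn (φ : Formula A) (B : Finset A) : Prop :=
  ∀ (D : Type u) (V V' : A → Set D) (g : ℕ → D),
    Holds V g φ → BExtends B V V' → Holds V' g φ

/-- Continuity in `B`. (On an empty domain there is just one valuation, so nothing is
required there.) -/
def IsContinuousIn (φ : Formula A) (B : Finset A) : Prop :=
  IsMonotoneIn.{u} φ B ∧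
    ∀ (D : Type u) (V : A → Set D) (g : ℕ → D), Holds V g φ →
      ∃ U : A → Set D, BExtends B U V ∧ (∀ b ∈ B, (U b).Finite) ∧ Holds U g φ

/-! ### Basic formulas -/

/-- Finite conjunction; the empty one is `⊤`. -/
def bigAnd (l : List (Formula A)) : Formula A := l.foldr and top

/-- Finite disjunction; the empty one is `⊥`. -/
def bigOr (l : List (Formula A)) : Formula A := l.foldr or bot

/-- `∃ x₁ … xₙ. φ`. -/
def exList (xs : List ℕ) (φ : Formula A) : Formula A := xs.foldr ex φ

/-- The conjunction of all `yₘ ≉ yₘ'` with `m < m'`. -/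
def diff : List ℕ → Formula A
  | [] => top
  | y :: ys => and (bigAnd (ys.map fun y' => neq y y')) (diff ys)

/-- The disjunction of all `yₘ ≈ yₘ'` with `m < m'`. -/
def someEq : List ℕ → Formula A
  | [] => bot
  | y :: ys => or (bigOr (ys.map fun y' => eq y y')) (someEq ys)

/-- `diff(ys) → ψ`, which abbreviates the disjunction of all `yₘ ≈ yₘ'` with `m < m'` and `ψ`. -/
def diffImp (ys : List ℕ) (ψ : Formula A) : Formula A := or (someEq ys) ψ

variable [Fintype A] [DecidableEq A]

/-- The `B`-positive type `τ^B_S(x)`: the conjunction of all `b(x)` for `b ∈ S` and all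
`¬ b(x)` for `b ∈ A \ (S ∪ B)`. -/
noncomputable def typ (B S : Finset A) (x : ℕ) : Formula A :=
  and (bigAnd (S.toList.map fun b => pred b x))
    (bigAnd ((S ∪ B)ᶜ.toList.map fun b => npred b x))

/-- The disjunction of the `τ^B_S(x)` for `S ∈ L`. -/
noncomputable def someTyp (B : Finset A) (L : Finset (Finset A)) (x : ℕ) : Formula A :=
  bigOr (L.toList.map fun S => typ B S x)

/-- `∇^B_FOE(T, L)`, i.e.
`∃ x₁ … xₙ. (diff(x₁ … xₙ) ∧ ⋀ᵢ τ^B_{Tᵢ}(xᵢ) ∧ ∀ z. (diff(x₁ … xₙ, z) → ⋁_{S ∈ L} τ^B_S(z)))`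
where the variables `x₁, …, xₙ, z` are `0, …, n - 1, n`. -/
noncomputable def nablaFOE (B : Finset A) (T : List (Finset A)) (L : Finset (Finset A)) :
    Formula A :=
  exList (List.range T.length)
    (and (diff (List.range T.length))
      (and (bigAnd (T.zipIdx.map fun p => typ B p.1 p.2))
        (all T.length
          (diffImp (List.range T.length ++ [T.length]) (someTyp B L T.length)))))

/-- `∇^B_∞(Sg)`, i.e. `⋀_{S ∈ Sg} ∃^∞ y. τ^B_S(y) ∧ ∀^∞ y. ⋁_{S ∈ Sg} τ^B_S(y)`. -/
noncomputable def nablaInf (B : Finset A) (Sg : Finset (Finset A)) : Formula A :=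
  and (bigAnd (Sg.toList.map fun S => exInf 0 (typ B S 0))) (allInf 0 (someTyp B Sg 0))

/-- The `B`-positive basic formula `∇^B(T, P, Sg) = ∇^B_FOE(T, P ∪ Sg) ∧ ∇^B_∞(Sg)`. -/
noncomputable def nabla (B : Finset A) (T : List (Finset A)) (P Sg : Finset (Finset A)) :
    Formula A :=
  and (nablaFOE B T (P ∪ Sg)) (nablaInf B Sg)

/-- `ψ` is a finite disjunction of formulas `∇^C(T, P, Sg)` such that `Sg ⊆ P ⊆ T` and
`B ∩ ⋃ Sg = ∅`. For `C = B` these are the `B`-positive basic formulas, for `C = A` the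
(fully) positive ones. -/
def IsNormalForm (C B : Finset A) (ψ : Formula A) : Prop :=
  ∃ L : List (List (Finset A) × Finset (Finset A) × Finset (Finset A)),
    (∀ t ∈ L, t.2.2 ⊆ t.2.1 ∧ t.2.1 ⊆ t.1.toFinset ∧ B ∩ t.2.2.biUnion id = ∅) ∧
      ψ = bigOr (L.map fun t => nabla C t.1 t.2.1 t.2.2)

end Formula

/-! ### Effective maps on formulas -/

/-- The letters used to write down formulas, which are the possible labels of a node of a syntax
tree: `⊤, ⊥, ∨, ∧`; the literals `a(x)` and `¬ a(x)`; the (in)equalities `x ≈ y` and `x ≉ y`;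
the quantifiers `∃ x, ∀ x, ∃^∞ x, ∀^∞ x`. -/
abbrev Letter (A : Type v) : Type v :=
  Fin 4 ⊕ (Bool × A × ℕ) ⊕ (Bool × ℕ × ℕ) ⊕ (Fin 4 × ℕ)

/-- The formula written in Polish (prefix) notation. -/
def Formula.word {A : Type v} : Formula A → List (Letter A)
  | .top => [.inl 0]
  | .bot => [.inl 1]
  | .pred a x => [.inr (.inl (true, a, x))]
  | .npred a x => [.inr (.inl (false, a, x))]
  | .eq x y => [.inr (.inr (.inl (true, x, y)))]
  | .neq x y => [.inr (.inr (.inl (false, x, y)))]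
  | .or φ ψ => .inl 2 :: (φ.word ++ ψ.word)
  | .and φ ψ => .inl 3 :: (φ.word ++ ψ.word)
  | .ex x φ => .inr (.inr (.inr (0, x))) :: φ.word
  | .all x φ => .inr (.inr (.inr (1, x))) :: φ.word
  | .exInf x φ => .inr (.inr (.inr (2, x))) :: φ.word
  | .allInf x φ => .inr (.inr (.inr (3, x))) :: φ.word

/-- Unique readability: a formula can be recovered from its word. -/
theorem Formula.word_append_inj {A : Type v} (φ : Formula A) :
    ∀ (ψ : Formula A) (l m : List (Letter A)),
      φ.word ++ l = ψ.word ++ m → φ = ψ ∧ l = m := by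
  induction φ with
  | or φ₁ φ₂ ih₁ ih₂ =>
    intro ψ l m h
    cases ψ <;> simp [Formula.word] at h ⊢
    obtain ⟨h₁, h⟩ := ih₁ _ _ _ h
    obtain ⟨h₂, h⟩ := ih₂ _ _ _ h
    exact ⟨⟨h₁, h₂⟩, h⟩
  | and φ₁ φ₂ ih₁ ih₂ =>
    intro ψ l m h
    cases ψ <;> simp [Formula.word] at h ⊢
    obtain ⟨h₁, h⟩ := ih₁ _ _ _ h
    obtain ⟨h₂, h⟩ := ih₂ _ _ _ h
    exact ⟨⟨h₁, h₂⟩, h⟩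
  | ex x φ ih | all x φ ih | exInf x φ ih | allInf x φ ih =>
    intro ψ l m h
    cases ψ <;> simp [Formula.word] at h ⊢
    obtain ⟨h₁, h₂⟩ := ih _ _ _ h.2
    exact ⟨⟨h.1, h₁⟩, h₂⟩
  | _ =>
    intro ψ l m h
    cases ψ <;> simp_all [Formula.word]

/-- A map on formulas is effective if there is a computable function on words that sends the word
of each formula to the word of its image. -/
def IsEffective {A : Type v} [Primcodable A] (f : Formula A → Formula A) : Prop :=
  ∃ F : List (Letter A) → List (Letter A), Computable F ∧ ∀ φ, F φ.word = (f φ).word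

end Monadic

/-!
A model is determined, up to what a sentence with at most `m` variables can say, by the number of
elements of each type (set of predicates satisfied by an element), where finite numbers above `m`
are not told apart but infinite ones are (`Realizes`, with the back-and-forth argument in
`exists_fresh`, `Realizes.exists_iff_infinite` and `Realizes.mem_table_iff`). Such a description is
a list `T` of types together with the set `Sg` of the types that occur infinitely often, and up to
the order of `T` only finitely many of them are needed (`exists_nablaHolds`).

Let `B ⊆ C`. The normal form of `φ` (`normalForm`) is the disjunction of the `∇^C(T, P, Sg)` over
those descriptions in which `φ` is true and no type in `Sg` meets `B`; here `P ⊇ Sg` is a set of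
types that occur more than `m` times in `T`. Two facts about it carry the theorem.

* If `φ` is continuous in `B`, then every model of `φ` can be shrunk to one in which the predicates
  of `B` are finite. This one satisfies a disjunct, because types occurring infinitely often avoid
  `B`, and so does the original model, because `∇^C` is monotone in `C`.
* Conversely, a model of `∇^C(T, P, Sg)` can be shrunk, within `≤_C`, to a model in which each
  element has exactly one of the prescribed types and each type in `Sg` still occurs infinitely
  often (`NablaHolds.exists_shrink`). The smaller model has the description `(T, Sg)`, so `φ` is true
  in it, and in the larger model if `φ` is monotone in `C`. All but finitely many elements of the
  smaller model have a type in `Sg`, so the predicates in `B` are finite there. This also shows that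
  every normal form is continuous in `B`.

The first part of the theorem is the case `C = B`, the second the case `C = univ`.

The normal form is computable since truth in `(T, Sg)` is decided on the syntax tree: a stack
machine reads the word of the formula from right to left and computes for each subformula the finite
list of environments satisfying it (`step`, `table`, `foldr_step_word`). All of its steps are
primitive recursive (`isEffective_normalForm`).
-/

namespace Monadic.Formula

variable {A : Type v}

/-! ### The semantics of basic formulas -/

section Semantics

variable {D : Type u}

theorem holds_congr (V : A → Set D) (φ : Formula A) :
    ∀ g g' : ℕ → D, (∀ x ∈ φ.freeVars, g x = g' x) → (Holds V g φ ↔ Holds V g' φ) := by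
  have upd : ∀ (s : Finset ℕ) (x : ℕ) (g g' : ℕ → D), (∀ y ∈ s.erase x, g y = g' y) →
      ∀ d : D, ∀ y ∈ s, Function.update g x d y = Function.update g' x d y := by
    intro s x g g' h d y hy
    by_cases hyx : y = x
    · subst hyx; simp
    · simpa [hyx] using h y (by simp [hyx, hy])
  induction φ with
  | top | bot => intros; exact Iff.rfl
  | pred a x | npred a x => intro g g' h; simp [Holds, h x (by simp [freeVars])]
  | eq x y | neq x y =>
    intro g g' h; simp [Holds, h x (by simp [freeVars]), h y (by simp [freeVars])]
  | or φ ψ ih₁ ih₂ | and φ ψ ih₁ ih₂ =>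
    intro g g' h
    simp only [Holds]
    rw [ih₁ g g' fun x hx => h x (by simp [freeVars, hx]),
      ih₂ g g' fun x hx => h x (by simp [freeVars, hx])]
  | ex x φ ih | all x φ ih | exInf x φ ih | allInf x φ ih =>
    intro g g' h
    simp only [Holds, fun d => ih _ _ (upd _ x g g' h d)]

theorem IsSentence.holds_iff {φ : Formula A} (hφ : φ.IsSentence) (V : A → Set D) (g g' : ℕ → D) :
    Holds V g φ ↔ Holds V g' φ :=
  holds_congr V φ g g' (by rw [hφ]; simp)

theorem IsSentence.models_iff {φ : Formula A} (hφ : φ.IsSentence) (V : A → Set D) (g : ℕ → D) :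
    Models V φ ↔ Holds V g φ := by
  have : Nonempty D := ⟨g 0⟩
  simp only [Models, not_isEmpty_of_nonempty, false_and, false_or, this, true_and]
  exact ⟨fun h => h g, fun h g' => (hφ.holds_iff V g g').1 h⟩

theorem models_of_isEmpty [IsEmpty D] (V : A → Set D) (φ : Formula A) :
    Models V φ ↔ φ.HoldsEmpty := by
  simp [Models, ‹IsEmpty D›]

/-- Positive formulas are monotone in all predicates. -/
theorem IsPositive.isMonotoneIn [Fintype A] {φ : Formula A} (hφ : φ.IsPositive) :
    IsMonotoneIn.{u} φ Finset.univ := by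
  intro D V V' g h hV
  have hV' : ∀ a, V a ⊆ V' a := fun a => hV.1 a (Finset.mem_univ a)
  clear hV
  induction φ generalizing g with
  | top => trivial
  | bot => exact h
  | pred a x => exact hV' a h
  | npred a x => exact hφ.elim
  | eq x y | neq x y => exact h
  | or φ ψ ih₁ ih₂ => exact h.imp (ih₁ hφ.1 g) (ih₂ hφ.2 g)
  | and φ ψ ih₁ ih₂ => exact h.imp (ih₁ hφ.1 g) (ih₂ hφ.2 g)
  | ex x φ ih => exact h.imp fun d => ih hφ _
  | all x φ ih => exact fun d => ih hφ _ (h d)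
  | exInf x φ ih => exact Set.Infinite.mono (fun d => ih hφ _) h
  | allInf x φ ih => exact Set.Finite.subset h fun d hd h' => hd (ih hφ _ h')

theorem holds_bigAnd (V : A → Set D) (g : ℕ → D) (l : List (Formula A)) :
    Holds V g (bigAnd l) ↔ ∀ φ ∈ l, Holds V g φ := by
  induction l with
  | nil => simp [bigAnd, Holds]
  | cons φ l ih => simpa [bigAnd, Holds] using fun _ => ih

theorem holds_bigAnd_map {β : Type*} (V : A → Set D) (g : ℕ → D) (f : β → Formula A) (l : List β) :
    Holds V g (bigAnd (l.map f)) ↔ ∀ b ∈ l, Holds V g (f b) := by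
  rw [holds_bigAnd, List.forall_mem_map]

theorem holds_bigOr (V : A → Set D) (g : ℕ → D) (l : List (Formula A)) :
    Holds V g (bigOr l) ↔ ∃ φ ∈ l, Holds V g φ := by
  induction l with
  | nil => simp [bigOr, Holds]
  | cons φ l ih => simpa [bigOr, Holds] using or_congr Iff.rfl ih

theorem holds_bigOr_map {β : Type*} (V : A → Set D) (g : ℕ → D) (f : β → Formula A) (l : List β) :
    Holds V g (bigOr (l.map f)) ↔ ∃ b ∈ l, Holds V g (f b) := by
  rw [holds_bigOr]
  simp

theorem holdsEmpty_bigOr_map {β : Type*} (f : β → Formula A) (l : List β) :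
    (bigOr (l.map f)).HoldsEmpty ↔ ∃ b ∈ l, (f b).HoldsEmpty := by
  induction l with
  | nil => simp [bigOr, HoldsEmpty]
  | cons φ l ih => simpa [bigOr, HoldsEmpty] using or_congr Iff.rfl ih

theorem holds_exList (V : A → Set D) (φ : Formula A) (xs : List ℕ) (g : ℕ → D) :
    Holds V g (exList xs φ) ↔ ∃ g' : ℕ → D, (∀ y ∉ xs, g' y = g y) ∧ Holds V g' φ := by
  induction xs generalizing g with
  | nil =>
    refine ⟨fun h => ⟨g, by simp, h⟩, ?_⟩
    rintro ⟨g', hg, h⟩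
    rwa [show g = g' from funext fun y => (hg y (by simp)).symm]
  | cons x xs ih =>
    change (∃ d, Holds V (Function.update g x d) (exList xs φ)) ↔ _
    simp only [ih]
    constructor
    · rintro ⟨d, g', hg, h⟩
      refine ⟨g', fun y hy => ?_, h⟩
      rw [List.mem_cons, not_or] at hy
      rw [hg y hy.2, Function.update_of_ne hy.1]
    · rintro ⟨g', hg, h⟩
      refine ⟨g' x, g', fun y hy => ?_, h⟩
      by_cases hyx : y = x
      · subst hyx; simp
      · rw [Function.update_of_ne hyx, hg y (by simp [hyx, hy])]

theorem holds_diff (V : A → Set D) (g : ℕ → D) (ys : List ℕ) :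
    Holds V g (diff ys) ↔ ys.Pairwise fun y y' => g y ≠ g y' := by
  induction ys with
  | nil => simp [diff, Holds]
  | cons y ys ih => simp [diff, Holds, holds_bigAnd, ih]

theorem holds_someEq (V : A → Set D) (g : ℕ → D) (ys : List ℕ) :
    Holds V g (someEq ys) ↔ ¬ ys.Pairwise fun y y' => g y ≠ g y' := by
  induction ys with
  | nil => simp [someEq, Holds]
  | cons y ys ih => simp [someEq, Holds, holds_bigOr, ih, imp_iff_not_or]

theorem pairwise_range_ne_iff (g : ℕ → D) (n : ℕ) :
    ((List.range n).Pairwise fun y y' => g y ≠ g y') ↔ Set.InjOn g {i | i < n} := by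
  rw [List.pairwise_iff_getElem]
  simp only [List.length_range, List.getElem_range]
  constructor
  · intro h i hi j hj hij
    by_contra hne
    rcases lt_or_gt_of_ne hne with hlt | hlt
    · exact h i j hi hj hlt hij
    · exact h j i hj hi hlt hij.symm
  · intro h i j hi hj hlt heq
    exact hlt.ne (h hi hj heq)

variable [Fintype A] [DecidableEq A]

/-- The element `d` satisfies the `C`-positive type `τ^C_S`. -/
def Satisfies (V : A → Set D) (C S : Finset A) (d : D) : Prop :=
  (∀ a ∈ S, d ∈ V a) ∧ ∀ a ∉ S ∪ C, d ∉ V a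

theorem holds_typ (V : A → Set D) (g : ℕ → D) (C S : Finset A) (x : ℕ) :
    Holds V g (typ C S x) ↔ Satisfies V C S (g x) := by
  simp [typ, Holds, holds_bigAnd_map, Satisfies]

theorem holds_someTyp (V : A → Set D) (g : ℕ → D) (C : Finset A) (L : Finset (Finset A)) (x : ℕ) :
    Holds V g (someTyp C L x) ↔ ∃ S ∈ L, Satisfies V C S (g x) := by
  simp [someTyp, holds_bigOr_map, holds_typ]

/-- The truth condition of `∇^C(T, P, Sg)` in a nonempty model: `x` lists the witnesses for `T`. -/
def NablaHolds (V : A → Set D) (C : Finset A) (T : List (Finset A)) (P Sg : Finset (Finset A))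
    (x : ℕ → D) : Prop :=
  Set.InjOn x {i | i < T.length} ∧ (∀ i S, T[i]? = some S → Satisfies V C S (x i)) ∧
    (∀ z, (∀ i < T.length, x i ≠ z) → ∃ S ∈ P ∪ Sg, Satisfies V C S z) ∧
    (∀ S ∈ Sg, {y | Satisfies V C S y}.Infinite) ∧ {y | ¬ ∃ S ∈ Sg, Satisfies V C S y}.Finite

theorem holds_nabla (V : A → Set D) (g : ℕ → D) (C : Finset A) (T : List (Finset A))
    (P Sg : Finset (Finset A)) :
    Holds V g (nabla C T P Sg) ↔ ∃ x, NablaHolds V C T P Sg x := by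
  have key : ∀ x : ℕ → D, Holds V x (and (diff (List.range T.length))
      (and (bigAnd (T.zipIdx.map fun p => typ C p.1 p.2))
        (all T.length
          (diffImp (List.range T.length ++ [T.length]) (someTyp C (P ∪ Sg) T.length))))) ↔
      Set.InjOn x {i | i < T.length} ∧ (∀ i S, T[i]? = some S → Satisfies V C S (x i)) ∧
    (∀ z, (∀ i < T.length, x i ≠ z) → ∃ S ∈ P ∪ Sg, Satisfies V C S z) := by
    intro x
    simp only [Holds, holds_diff, pairwise_range_ne_iff, holds_bigAnd_map, diffImp, holds_someEq,
      holds_someTyp, Function.update_self]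
    refine and_congr_right fun hx => and_congr ?_ (forall_congr' fun z => ?_)
    · simp only [holds_typ, Prod.forall, List.mem_zipIdx_iff_getElem?]
      exact forall_comm
    · have hp : (List.range T.length).Pairwise fun y y' =>
          Function.update x T.length z y ≠ Function.update x T.length z y' := by
        rw [pairwise_range_ne_iff]
        intro i hi j hj hij
        rw [Function.update_of_ne (ne_of_lt hi), Function.update_of_ne (ne_of_lt hj)] at hij
        exact hx hi hj hij
      have hz : (∀ i < T.length, Function.update x T.length z i ≠ z) ↔
          ∀ i < T.length, x i ≠ z :=
        forall₂_congr fun i hi => by rw [Function.update_of_ne (ne_of_lt hi)]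
      have hq : ((List.range T.length ++ [T.length]).Pairwise fun y y' =>
          Function.update x T.length z y ≠ Function.update x T.length z y') ↔
          ∀ i < T.length, x i ≠ z := by
        rw [List.pairwise_append, ← hz]
        simp [hp]
      rw [hq, imp_iff_not_or]
  have inf : Holds V g (nablaInf C Sg) ↔ (∀ S ∈ Sg, {y | Satisfies V C S y}.Infinite) ∧
      {y | ¬ ∃ S ∈ Sg, Satisfies V C S y}.Finite := by
    simp [nablaInf, Holds, holds_bigAnd, holds_someTyp, holds_typ]
  have foe : Holds V g (nabla C T P Sg) ↔
      Holds V g (nablaFOE C T (P ∪ Sg)) ∧ Holds V g (nablaInf C Sg) := Iff.rfl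
  rw [foe, nablaFOE, holds_exList, inf]
  simp only [key]
  constructor
  · rintro ⟨⟨x, -, h₁, h₂, h₃⟩, h⟩
    exact ⟨x, h₁, h₂, h₃, h⟩
  · rintro ⟨x, h₁, h₂, h₃, h⟩
    refine ⟨⟨fun i => if i < T.length then x i else g i, by simp +contextual, ?_, ?_, ?_⟩, h⟩
    · intro i hi j hj hij
      simp only [show i < T.length from hi, show j < T.length from hj, if_true] at hij
      exact h₁ hi hj hij
    · intro i S hi
      obtain ⟨hlt, -⟩ := List.getElem?_eq_some_iff.1 hi
      simpa [hlt] using h₂ i S hi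
    · intro z hz
      exact h₃ z fun i hi => by simpa [hi] using hz i hi

theorem holdsEmpty_nabla (C : Finset A) {T : List (Finset A)} {P Sg : Finset (Finset A)}
    (hSg : Sg ⊆ P) (hP : P ⊆ T.toFinset) : (nabla C T P Sg).HoldsEmpty ↔ T = [] := by
  cases T with
  | nil =>
    obtain rfl : P = ∅ := by simpa using hP
    obtain rfl : Sg = ∅ := by simpa using hSg
    simp [nabla, nablaFOE, nablaInf, exList, diff, bigAnd, HoldsEmpty]
  | cons S T =>
    simp [nabla, nablaFOE, List.range_succ_eq_map, exList, HoldsEmpty]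

end Semantics

/-! ### Shrinking a valuation to the exact types of a basic formula -/

section Shrinking

variable {D : Type u}

/-- An infinite set can be split into two infinite parts. -/
theorem _root_.Set.Infinite.exists_infinite_infinite_diff {Z : Set D} (hZ : Z.Infinite) :
    ∃ Y ⊆ Z, Y.Infinite ∧ (Z \ Y).Infinite := by
  let f := hZ.natEmbedding
  have hf : Function.Injective fun n => (f n : D) := Subtype.val_injective.comp f.injective
  refine ⟨Set.range fun n => (f (2 * n) : D), ?_, ?_, ?_⟩
  · rintro _ ⟨n, rfl⟩
    exact (f _).2
  · exact Set.infinite_range_of_injective fun m n h => by simpa using hf h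
  · refine (Set.infinite_range_of_injective (f := fun n => (f (2 * n + 1) : D))
      fun m n h => by simpa using hf h).mono ?_
    rintro _ ⟨n, rfl⟩
    refine ⟨(f _).2, ?_⟩
    rintro ⟨m, hm⟩
    have := hf hm
    omega

/-- Finitely many infinite sets contain pairwise disjoint infinite subsets; these are given as the
fibres of a partial function `k`. -/
theorem exists_disjoint_infinite {W : Type*} [DecidableEq W] (s : Finset W) (X : W → Set D)
    (hX : ∀ S ∈ s, (X S).Infinite) :
    ∃ k : D → Option W, (∀ y S, k y = some S → S ∈ s ∧ y ∈ X S) ∧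
      ∀ S ∈ s, {y | k y = some S}.Infinite := by
  classical
  induction s using Finset.induction_on with
  | empty => exact ⟨fun _ => none, by simp, by simp⟩
  | insert S₀ s hS₀ ih =>
    obtain ⟨k, hk, hinf⟩ := ih fun S hS => hX S (Finset.mem_insert_of_mem hS)
    -- `k` takes finitely many values, so it is constant on an infinite subset of `X S₀`.
    have hfin : (k '' X S₀).Finite := by
      refine ((s.finite_toSet.image some).insert none).subset ?_
      rintro _ ⟨y, -, rfl⟩
      cases h : k y with
      | none => simp
      | some S => simpa using (hk y S h).1
    obtain ⟨o, ho⟩ : ∃ o, {y ∈ X S₀ | k y = o}.Infinite := by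
      by_contra! hcon
      refine hX S₀ (Finset.mem_insert_self _ _) ((hfin.biUnion fun o _ => hcon o).subset ?_)
      intro y hy
      exact Set.mem_biUnion (Set.mem_image_of_mem k hy) ⟨hy, rfl⟩
    obtain ⟨Y, hYZ, hY, hZY⟩ := ho.exists_infinite_infinite_diff
    refine ⟨fun y => if y ∈ Y then some S₀ else k y, ?_, ?_⟩
    · intro y S h
      by_cases hy : y ∈ Y
      · obtain rfl : S₀ = S := by simpa [hy] using h
        exact ⟨Finset.mem_insert_self _ _, (hYZ hy).1⟩
      · obtain ⟨h₁, h₂⟩ := hk y S (by simpa [hy] using h)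
        exact ⟨Finset.mem_insert_of_mem h₁, h₂⟩
    · intro S hS
      by_cases hSS : S = S₀
      · subst hSS
        exact hY.mono fun y hy => by simp [hy]
      · by_cases hoS : o = some S
        · refine hZY.mono fun y hy => ?_
          simp [hy.2, hy.1.2, hoS]
        · refine (hinf S (Finset.mem_of_mem_insert_of_ne hS hSS)).mono fun y hy => ?_
          have : y ∉ Y := fun h => hoS ((hYZ h).2.symm.trans hy)
          simpa [this] using hy

open Classical in
/-- The type of an element: the set of all predicates it satisfies. -/
noncomputable def typeOf [Fintype A] (V : A → Set D) (d : D) : Finset A := {a | d ∈ V a}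

theorem mem_typeOf [Fintype A] {V : A → Set D} {d : D} {a : A} : a ∈ typeOf V d ↔ d ∈ V a := by
  simp [typeOf]

variable [DecidableEq A]

theorem satisfies_empty_iff [Fintype A] {V : A → Set D} {S : Finset A} {d : D} :
    Satisfies V ∅ S d ↔ typeOf V d = S := by
  simp only [Satisfies, Finset.union_empty, Finset.ext_iff, mem_typeOf]
  exact ⟨fun h a => ⟨fun ha => by_contra fun hS => h.2 a hS ha, h.1 a⟩,
    fun h => ⟨fun a ha => (h a).2 ha, fun a ha hd => ha ((h a).1 hd)⟩⟩

theorem Satisfies.of_empty {V : A → Set D} {S : Finset A} {d : D} (h : Satisfies V ∅ S d)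
    (C : Finset A) : Satisfies V C S d :=
  ⟨h.1, fun a ha => h.2 a fun h => ha (by simp_all)⟩

theorem Satisfies.of_bExtends {U V : A → Set D} {C S : Finset A} {d : D} (h : Satisfies U C S d)
    (hUV : BExtends C U V) : Satisfies V C S d := by
  refine ⟨fun a ha => ?_, fun a ha => ?_⟩
  · by_cases haC : a ∈ C
    · exact hUV.1 a haC (h.1 a ha)
    · exact hUV.2 a haC ▸ h.1 a ha
  · exact hUV.2 a (fun haC => ha (Finset.mem_union_right _ haC)) ▸ h.2 a ha

theorem BExtends.mono {U V : A → Set D} {B C : Finset A} (hBC : B ⊆ C) (h : BExtends B U V) :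
    BExtends C U V := by
  refine ⟨fun a _ => ?_, fun a ha => h.2 a fun haB => ha (hBC haB)⟩
  by_cases haB : a ∈ B
  · exact h.1 a haB
  · exact (h.2 a haB).subset

theorem NablaHolds.imp {U V : A → Set D} {C C' : Finset A} {T : List (Finset A)}
    {P Sg : Finset (Finset A)} {x : ℕ → D} (h : NablaHolds U C T P Sg x)
    (hUV : ∀ S d, Satisfies U C S d → Satisfies V C' S d) : NablaHolds V C' T P Sg x := by
  obtain ⟨h₁, h₂, h₃, h₄, h₅⟩ := h
  refine ⟨h₁, fun i S hi => hUV _ _ (h₂ i S hi), fun z hz => (h₃ z hz).imp fun S => ?_,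
    fun S hS => (h₄ S hS).mono fun d => hUV S d, h₅.subset fun d hd h => hd (h.imp fun S => ?_)⟩
  · exact And.imp_right (hUV S z)
  · exact And.imp_right (hUV S d)

variable [Fintype A]

/-- A model of `∇^C(T, P, Sg)` can be shrunk to a model in which every element has exactly one of
the prescribed types. If the types in `Sg` are disjoint from `B`, then all predicates in `B` become
finite, since all but finitely many elements have a type in `Sg`. -/
theorem NablaHolds.exists_shrink {V : A → Set D} {B C : Finset A} {T : List (Finset A)}
    {P Sg : Finset (Finset A)} {x : ℕ → D} (h : NablaHolds V C T P Sg x)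
    (hB : B ∩ Sg.biUnion id = ∅) :
    ∃ U : A → Set D, BExtends C U V ∧ (∀ b ∈ B, (U b).Finite) ∧ NablaHolds U ∅ T P Sg x := by
  classical
  obtain ⟨hinj, hT, hP, hinf, hfin⟩ := h
  have hwit : (x '' {i | i < T.length}).Finite := (Set.finite_lt_nat _).image x
  obtain ⟨k, hk, hkinf⟩ := exists_disjoint_infinite Sg
    (fun S => {y | Satisfies V C S y} \ x '' {i | i < T.length})
    fun S hS => (hinf S hS).sdiff hwit
  -- The type chosen for `y`: that of `T` for a witness; `k y` if defined, so that each type in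
  -- `Sg` is chosen infinitely often; a type in `Sg` whenever possible, and one in `P` otherwise.
  have hch : ∀ y, ∃ S, Satisfies V C S y ∧ (∀ i S', T[i]? = some S' → x i = y → S = S') ∧
      ((∀ i < T.length, x i ≠ y) → S ∈ P ∪ Sg) ∧ (∀ S', k y = some S' → S = S') ∧
      ((∀ i < T.length, x i ≠ y) → (∃ S ∈ Sg, Satisfies V C S y) → S ∈ Sg) := by
    intro y
    by_cases hy : ∃ i, i < T.length ∧ x i = y
    · obtain ⟨i, hi, rfl⟩ := hy
      refine ⟨T[i], hT i _ (by simp [hi]), ?_, fun h => (h i hi rfl).elim, ?_,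
        fun h => (h i hi rfl).elim⟩
      · intro j S' hj hji
        obtain ⟨hj', rfl⟩ := List.getElem?_eq_some_iff.1 hj
        obtain rfl := hinj hj' hi hji
        rfl
      · intro S' hS'
        exact ((hk _ _ hS').2.2 ⟨i, hi, rfl⟩).elim
    · have hy' : ∀ i < T.length, x i ≠ y := fun i hi h => hy ⟨i, hi, h⟩
      have hw : ∀ S : Finset A, ∀ i S', T[i]? = some S' → x i = y → S = S' := by
        intro S i S' hi hxi
        obtain ⟨hi', -⟩ := List.getElem?_eq_some_iff.1 hi
        exact (hy' i hi' hxi).elim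
      cases hky : k y with
      | some S =>
        obtain ⟨hS, hyS⟩ := hk y S hky
        exact ⟨S, hyS.1, hw S, fun _ => Finset.mem_union_right _ hS, by simp, fun _ _ => hS⟩
      | none =>
        by_cases hS : ∃ S ∈ Sg, Satisfies V C S y
        · obtain ⟨S, hS, hyS⟩ := hS
          exact ⟨S, hyS, hw S, fun _ => Finset.mem_union_right _ hS, by simp, fun _ _ => hS⟩
        · obtain ⟨S, hSP, hyS⟩ := hP y hy'
          exact ⟨S, hyS, hw S, fun _ => hSP, by simp, fun _ h => (hS h).elim⟩
  choose h hsat hwitness hmem hk' hSg using hch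
  have htype : ∀ d, typeOf (fun a => {d | a ∈ h d}) d = h d := fun d => by
    ext a; simp [mem_typeOf]
  have hcofin : {y | h y ∉ Sg}.Finite := by
    refine (hwit.union hfin).subset fun y hy => ?_
    by_cases hyw : y ∈ x '' {i | i < T.length}
    · exact Or.inl hyw
    · exact Or.inr fun hS => hy (hSg y (fun i hi hxi => hyw ⟨i, hi, hxi⟩) hS)
  refine ⟨fun a => {d | a ∈ h d}, ⟨?_, ?_⟩, ?_, hinj, ?_, ?_, ?_, ?_⟩
  · exact fun a _ d hd => (hsat d).1 a hd
  · intro a ha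
    ext d
    refine ⟨(hsat d).1 a, fun hd => by_contra fun hd' => (hsat d).2 a ?_ hd⟩
    simpa [ha] using hd'
  · intro b hb
    refine hcofin.subset fun d hd hdS => ?_
    exact Finset.notMem_empty b (hB ▸ Finset.mem_inter.2 ⟨hb, Finset.mem_biUnion.2 ⟨_, hdS, hd⟩⟩)
  · intro i S hi
    rw [satisfies_empty_iff, htype]
    exact hwitness _ i S hi rfl
  · intro z hz
    exact ⟨_, hmem z hz, satisfies_empty_iff.2 (htype z)⟩
  · intro S hS
    refine (hkinf S hS).mono fun y hy => ?_
    rw [Set.mem_ofPred_eq, satisfies_empty_iff, htype]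
    exact hk' y S hy
  · refine hcofin.subset fun y hy hyS => hy ⟨h y, hyS, ?_⟩
    rw [satisfies_empty_iff, htype]

/-- Every formula equivalent to a normal form is continuous. -/
theorem IsNormalForm.isContinuousIn {B C : Finset A} (hBC : B ⊆ C) {φ ψ : Formula A}
    (hφ : φ.IsSentence) (hψ : ψ.IsNormalForm C B) (h : Equivalent.{u} φ ψ) :
    IsContinuousIn.{u} φ B := by
  obtain ⟨L, hL, rfl⟩ := hψ
  have key : ∀ (D : Type u) (V : A → Set D) (g : ℕ → D), Holds V g φ ↔
      ∃ t ∈ L, ∃ x, NablaHolds V C t.1 t.2.1 t.2.2 x := by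
    intro D V g
    have : Nonempty D := ⟨g 0⟩
    rw [← hφ.models_iff, h]
    simp only [Models, not_isEmpty_of_nonempty, false_and, false_or, this, true_and, 
      holds_bigOr_map, holds_nabla]
    exact ⟨fun h => h g, fun h _ => h⟩
  refine ⟨fun D V V' g hV hVV' => ?_, fun D V g hV => ?_⟩
  · rw [key] at hV ⊢
    obtain ⟨t, ht, x, hx⟩ := hV
    exact ⟨t, ht, x, hx.imp fun S d hd => hd.of_bExtends (hVV'.mono hBC)⟩
  · rw [key] at hV
    obtain ⟨t, ht, x, hx⟩ := hV
    obtain ⟨U, hUV, hfin, hU⟩ := hx.exists_shrink (hL t ht).2.2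
    -- Only the predicates in `B` are shrunk; those in `C \ B` keep their values.
    refine ⟨fun a => if a ∈ B then U a else V a, ⟨?_, ?_⟩, ?_, ?_⟩
    · intro b hb
      simpa [hb] using hUV.1 b (hBC hb)
    · intro a ha
      simp [ha]
    · intro b hb
      simpa [hb] using hfin b hb
    · rw [key]
      refine ⟨t, ht, x, hU.imp fun S d hd => (hd.of_empty C).of_bExtends ⟨?_, ?_⟩⟩
      · intro a ha
        by_cases haB : a ∈ B
        · simp [haB]
        · simpa [haB] using hUV.1 a ha
      · intro a ha
        simpa [show a ∉ B from fun haB => ha (hBC haB)] using hUV.2 a ha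

end Shrinking

/-! ### Evaluating formulas in finite structures -/

section Tables

/-- All lists of length `n` with entries in `l`. -/
def tuples {α : Type*} (l : List α) : ℕ → List (List α)
  | 0 => [[]]
  | n + 1 => (tuples l n).flatMap fun t => l.map fun a => a :: t

theorem mem_tuples {α : Type*} {l : List α} {n : ℕ} {t : List α} :
    t ∈ tuples l n ↔ t.length = n ∧ ∀ a ∈ t, a ∈ l := by
  induction n generalizing t with
  | zero => simp +contextual [tuples]
  | succ n ih =>
    simp only [tuples, List.mem_flatMap, ih, List.mem_map]
    constructor
    · rintro ⟨t, ⟨rfl, ht⟩, a, ha, rfl⟩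
      simpa [ha] using ht
    · rintro ⟨hn, ht⟩
      cases t with
      | nil => simp at hn
      | cons a t =>
        rw [List.forall_mem_cons] at ht
        exact ⟨t, ⟨by simpa using hn, ht.2⟩, a, ht.1, rfl⟩

/-- The environments for `m` variables in the structure given by `T`. The value `T.length`, which
is not a position, makes sure that there are environments even if `T` is empty. -/
def envs (T : List (Finset A)) (m : ℕ) : List (List ℕ) := tuples (List.range (T.length + 1)) m

section BackAndForth

variable [Fintype A] {D : Type u}

/-- The model `(D, V)` is described by the finite structure `(T, Sg)` up to what can be expressed
with `m` variables: each type has the same number of elements in both, numbers above `m` not being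
distinguished, and `Sg` consists of the types with infinitely many elements. -/
def Realizes (V : A → Set D) (m : ℕ) (T : List (Finset A)) (Sg : Finset (Finset A)) : Prop :=
  (∀ S, min (m + 1 : ℕ∞) {d | typeOf V d = S}.encard = min (m + 1 : ℕ∞) 
      {i : ℕ | T[i]? = some S}.encard) ∧
    ∀ S, S ∈ Sg ↔ {d | typeOf V d = S}.Infinite

/-- The assignment `g` and the environment `e` have the same equality pattern and the same types on
the first `m` variables: they form a partial isomorphism. -/
def Agrees (V : A → Set D) (T : List (Finset A)) (m : ℕ) (g : ℕ → D) (e : List ℕ) : Prop :=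
  e.length = m ∧ (∀ y < m, T[e.getD y 0]? = some (typeOf V (g y))) ∧
    ∀ y < m, ∀ z < m, (g y = g z ↔ e.getD y 0 = e.getD z 0)

/-- The elements `d` and `d'` can be added to a partial isomorphism. -/
def Matches (V : A → Set D) (T : List (Finset A)) (m : ℕ) (g : ℕ → D) (e : List ℕ) (d : D)
    (d' : ℕ) : Prop :=
  T[d']? = some (typeOf V d) ∧ ∀ y < m, (g y = d ↔ e.getD y 0 = d')

theorem Agrees.update {V : A → Set D} {T : List (Finset A)} {m : ℕ} {g : ℕ → D} {e : List ℕ}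
    (h : Agrees V T m g e) {x : ℕ} (hx : x < m) {d : D} {d' : ℕ} (hd : Matches V T m g e d d') :
    Agrees V T m (Function.update g x d) (e.set x d') := by
  obtain ⟨rfl, h₁, h₂⟩ := h
  obtain ⟨hd₁, hd₂⟩ := hd
  have hset : ∀ y, (e.set x d').getD y 0 = Function.update (fun y => e.getD y 0) x d' y := by
    intro y
    by_cases hyx : y = x
    · subst hyx; simp [hx]
    · simp [Function.update_of_ne hyx, Ne.symm hyx]
  refine ⟨by simp, fun y hy => ?_, fun y hy z hz => ?_⟩
  · rw [hset]
    by_cases hyx : y = x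
    · subst hyx; simpa using hd₁
    · simpa [Function.update_of_ne hyx] using h₁ y hy
  · rw [hset, hset]
    by_cases hyx : y = x <;> by_cases hzx : z = x
    · simp [hyx, hzx]
    · subst hyx
      simpa [Function.update_of_ne hzx, eq_comm] using hd₂ z hz
    · subst hzx
      simpa [Function.update_of_ne hyx] using hd₂ y hy
    · simpa [Function.update_of_ne hyx, Function.update_of_ne hzx] using h₂ y hy z hz

/-- If two sets have the same number of elements up to `m + 1`, and one of them has an element that
does not occur among `m` given ones, then so has the other. -/
theorem exists_fresh {X Y : Type*} {m : ℕ} {P : Set X} {Q : Set Y}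
    (h : min (m + 1 : ℕ∞) P.encard = min (m + 1 : ℕ∞) Q.encard) {g : ℕ → X} {e : ℕ → Y}
    (hge : ∀ y < m, ∀ z < m, (g y = g z ↔ e y = e z)) (hPQ : ∀ y < m, (g y ∈ P ↔ e y ∈ Q))
    {d : X} (hd : d ∈ P) (hgd : ∀ y < m, g y ≠ d) : ∃ d' ∈ Q, ∀ y < m, e y ≠ d' := by
  by_contra! hcon
  let I : Set ℕ := {y | y < m ∧ g y ∈ P}
  have hIle : I.encard ≤ m := by
    refine (Set.encard_le_encard (t := (Finset.range m : Set ℕ)) fun y hy => ?_).trans_eq ?_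
    · simpa using hy.1
    · rw [Set.encard_coe_eq_coe_finsetCard, Finset.card_range]
  have hgI : (g '' I).encard ≤ m := (Set.encard_image_le g I).trans hIle
  have hQI : Q.encard ≤ (g '' I).encard := by
    choose! r hr using hcon
    refine Set.encard_le_encard_of_injOn (f := g ∘ r) (fun d' hd' => ?_) fun a ha b hb hab => ?_
    · refine ⟨r d', ⟨(hr d' hd').1, (hPQ _ (hr d' hd').1).2 ?_⟩, rfl⟩
      rwa [(hr d' hd').2]
    · rw [← (hr a ha).2, ← (hr b hb).2]
      exact (hge _ (hr a ha).1 _ (hr b hb).1).1 hab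
  have hdI : (g '' I).encard + 1 ≤ P.encard := by
    rw [← Set.encard_insert_of_notMem (a := d)]
    · refine Set.encard_le_encard (Set.insert_subset hd ?_)
      rintro _ ⟨y, hy, rfl⟩
      exact hy.2
    · rintro ⟨y, hy, hyd⟩
      exact hgd y hy.1 hyd
  have h₁ : (g '' I).encard + 1 ≤ min (m + 1 : ℕ∞) P.encard :=
    le_min (add_le_add_left hgI 1) hdI
  have h₂ : (g '' I).encard + 1 ≤ (g '' I).encard :=
    (h₁.trans_eq h).trans ((min_le_right _ _).trans hQI)
  have hne : (g '' I).encard ≠ ⊤ := ne_top_of_le_ne_top (ENat.natCast_ne_top m) hgI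
  exact absurd h₂ (not_le.2 ((ENat.lt_add_one_iff hne).2 le_rfl))

variable {V : A → Set D} {m : ℕ} {T : List (Finset A)} {Sg : Finset (Finset A)} {g : ℕ → D}
  {e : List ℕ}

theorem Realizes.exists_matches_forth (hR : Realizes V m T Sg) (h : Agrees V T m g e) (d : D) :
    ∃ d', Matches V T m g e d d' := by
  by_cases hd : ∃ y < m, g y = d
  · obtain ⟨y, hy, rfl⟩ := hd
    exact ⟨_, h.2.1 y hy, fun z hz => h.2.2 z hz y hy⟩
  · have hd' : ∀ y < m, g y ≠ d := fun y hy hyd => hd ⟨y, hy, hyd⟩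
    obtain ⟨d', hd'T, hd'e⟩ := exists_fresh (hR.1 (typeOf V d)) (g := g) (e := fun y => e.getD y 0)
      h.2.2 (fun y hy => by simp only [Set.mem_ofPred_eq, h.2.1 y hy, Option.some_inj])
      (d := d) rfl hd'
    exact ⟨d', hd'T, fun y hy => iff_of_false (hd' y hy) (hd'e y hy)⟩

theorem Realizes.exists_matches_back (hR : Realizes V m T Sg) (h : Agrees V T m g e) {d' : ℕ}
    (hd' : d' < T.length) : ∃ d, Matches V T m g e d d' := by
  by_cases hd : ∃ y < m, e.getD y 0 = d'
  · obtain ⟨y, hy, rfl⟩ := hd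
    exact ⟨_, h.2.1 y hy, fun z hz => h.2.2 z hz y hy⟩
  · have hde : ∀ y < m, e.getD y 0 ≠ d' := fun y hy hyd => hd ⟨y, hy, hyd⟩
    obtain ⟨d, hdT, hdg⟩ := exists_fresh (hR.1 T[d']).symm (g := fun y => e.getD y 0) (e := g)
      (fun y hy z hz => (h.2.2 y hy z hz).symm)
      (fun y hy => by simp only [Set.mem_ofPred_eq, h.2.1 y hy, Option.some_inj])
      (d := d') (List.getElem?_eq_getElem hd') hde
    refine ⟨d, ?_, fun y hy => iff_of_false (hdg y hy) (hde y hy)⟩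
    rw [show typeOf V d = T[d'] from hdT, List.getElem?_eq_getElem hd']

theorem Matches.lt {d : D} {d' : ℕ} (h : Matches V T m g e d d') : d' < T.length :=
  (List.getElem?_eq_some_iff.1 h.1).1

theorem Matches.getD {d : D} {d' : ℕ} (h : Matches V T m g e d d') :
    T.getD d' ∅ = typeOf V d := by
  simp [h.1]

theorem Agrees.notMem_iff (h : Agrees V T m g e) {d' : ℕ} :
    d' ∉ e ↔ ∀ y < m, e.getD y 0 ≠ d' := by
  obtain ⟨rfl, -⟩ := h
  rw [← not_iff_not]
  push Not
  rw [List.mem_iff_getElem]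
  exact ⟨fun ⟨y, hy, h⟩ => ⟨y, hy, by simpa [hy] using h⟩,
    fun ⟨y, hy, h⟩ => ⟨y, hy, by simpa [hy] using h⟩⟩

theorem Agrees.mem_envs (h : Agrees V T m g e) : e ∈ envs T m := by
  refine mem_tuples.2 ⟨h.1, fun d' hd' => ?_⟩
  obtain ⟨y, hy, rfl⟩ := List.mem_iff_getElem.1 hd'
  have hT := h.2.1 y (h.1 ▸ hy)
  have := (List.getElem?_eq_some_iff.1 hT).1
  simp [hy] at this
  simp [this.le]

/-- Infinitely many elements have a property, which depends only on their matching positions, if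
and only if there is a fresh position with that property and an infinite type. -/
theorem Realizes.exists_iff_infinite (hR : Realizes V m T Sg) (h : Agrees V T m g e) {p : D → Prop}
    {q : ℕ → Prop} (hpq : ∀ d d', Matches V T m g e d d' → (q d' ↔ p d)) :
    (∃ d' ∈ List.range T.length, (T.getD d' ∅ ∈ Sg ∧ d' ∉ e) ∧ q d') ↔ {d | p d}.Infinite := by
  classical
  have hgfin : (g '' {y | y < m}).Finite := (Set.finite_lt_nat m).image g
  constructor
  · rintro ⟨d', hd', ⟨hS, hfresh⟩, hq⟩
    rw [List.mem_range] at hd'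
    refine (((hR.2 _).1 hS).sdiff hgfin).mono fun d hd => ?_
    refine (hpq d d' ⟨?_, fun y hy => iff_of_false ?_ (h.notMem_iff.1 hfresh y hy)⟩).1 hq
    · rw [show typeOf V d = _ from hd.1]
      simp [hd']
    · exact fun hyd => hd.2 ⟨y, hy, hyd⟩
  · intro hinf
    have hfin : {d | typeOf V d ∉ Sg}.Finite := by
      refine ((Sgᶜ : Finset (Finset A)).finite_toSet.biUnion (t := fun S => {d | typeOf V d = S})
        fun S hS => ?_).subset fun d hd => Set.mem_biUnion (x := typeOf V d) ?_ rfl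
      · rw [Finset.mem_coe, Finset.mem_compl, hR.2, Set.not_infinite] at hS
        exact hS
      · simpa using hd
    obtain ⟨d, hd, hdn⟩ := (hinf.sdiff (hfin.union hgfin)).nonempty
    obtain ⟨d', hd'⟩ := hR.exists_matches_forth h d
    refine ⟨d', List.mem_range.2 hd'.lt, ⟨?_, ?_⟩, (hpq d d' hd').2 hd⟩
    · rw [hd'.getD]
      by_contra hS
      exact hdn (Or.inl hS)
    · rw [h.notMem_iff]
      exact fun y hy hyd => hdn (Or.inr ⟨y, hy, (hd'.2 y hy).2 hyd⟩)

theorem Realizes.exists_typeOf_eq_iff (hR : Realizes V m T Sg) (S : Finset A) :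
    (∃ d, typeOf V d = S) ↔ ∃ i : ℕ, T[i]? = some S := by
  have h := hR.1 S
  have h₁ : (1 : ℕ∞) ≤ m + 1 := le_add_self
  change {d | typeOf V d = S}.Nonempty ↔ {i : ℕ | T[i]? = some S}.Nonempty
  rw [← Set.one_le_encard_iff_nonempty, ← Set.one_le_encard_iff_nonempty]
  constructor <;> intro h'
  · exact (le_min h₁ h').trans (h.trans_le (min_le_right _ _))
  · exact (le_min h₁ h').trans (h.symm.trans_le (min_le_right _ _))

end BackAndForth

variable [DecidableEq A]

/-- One quantifier step in the structure whose elements are the positions `d < T.length`, the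
position `d` having the type `T[d]`. Here `t` is the list of environments that satisfy the formula
below the quantifier. A type in `Sg` stands for infinitely many elements, so `∃^∞` asks for a
position with such a type that does not occur in the environment `e`. -/
def quantHolds (T : List (Finset A)) (Sg : Finset (Finset A)) (t : List (List ℕ)) (e : List ℕ)
    (x : ℕ) : Fin 4 → Prop
  | 0 => ∃ d ∈ List.range T.length, e.set x d ∈ t
  | 1 => ∀ d ∈ List.range T.length, e.set x d ∈ t
  | 2 => ∃ d ∈ List.range T.length, (T.getD d ∅ ∈ Sg ∧ d ∉ e) ∧ e.set x d ∈ t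
  | 3 => ∀ d ∈ List.range T.length, ¬ (T.getD d ∅ ∈ Sg ∧ d ∉ e) ∨ e.set x d ∈ t

open Classical in
/-- One step of a stack machine that reads the word of a formula from right to left and works on a
stack of lists of environments. -/
noncomputable def step (T : List (Finset A)) (Sg : Finset (Finset A)) (m : ℕ) :
    Letter A → List (List (List ℕ)) → List (List (List ℕ))
  | .inl 0, st => envs T m :: st
  | .inl 1, st => [] :: st
  | .inl 2, st => (st.getD 0 [] ++ st.getD 1 []) :: st.drop 2
  | .inl 3, st => ((st.getD 0 []).filter fun e => e ∈ st.getD 1 []) :: st.drop 2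
  | .inr (.inl (b, a, x)), st =>
    ((envs T m).filter fun e => decide (a ∈ T.getD (e.getD x 0) ∅) = b) :: st
  | .inr (.inr (.inl (b, x, y))), st =>
    ((envs T m).filter fun e => decide (e.getD x 0 = e.getD y 0) = b) :: st
  | .inr (.inr (.inr (i, x))), st =>
    ((envs T m).filter fun e => quantHolds T Sg (st.getD 0 []) e x i) :: st.drop 1

open Classical in
/-- The environments that satisfy a formula. -/
noncomputable def table (T : List (Finset A)) (Sg : Finset (Finset A)) (m : ℕ) :
    Formula A → List (List ℕ)
  | top => envs T m
  | bot => []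
  | pred a x => (envs T m).filter fun e => decide (a ∈ T.getD (e.getD x 0) ∅) = true
  | npred a x => (envs T m).filter fun e => decide (a ∈ T.getD (e.getD x 0) ∅) = false
  | eq x y => (envs T m).filter fun e => decide (e.getD x 0 = e.getD y 0) = true
  | neq x y => (envs T m).filter fun e => decide (e.getD x 0 = e.getD y 0) = false
  | or φ ψ => table T Sg m φ ++ table T Sg m ψ
  | and φ ψ => (table T Sg m φ).filter fun e => e ∈ table T Sg m ψ
  | ex x φ => (envs T m).filter fun e => quantHolds T Sg (table T Sg m φ) e x 0
  | all x φ => (envs T m).filter fun e => quantHolds T Sg (table T Sg m φ) e x 1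
  | exInf x φ => (envs T m).filter fun e => quantHolds T Sg (table T Sg m φ) e x 2
  | allInf x φ => (envs T m).filter fun e => quantHolds T Sg (table T Sg m φ) e x 3

theorem foldr_step_word (T : List (Finset A)) (Sg : Finset (Finset A)) (m : ℕ) (φ : Formula A)
    (st : List (List (List ℕ))) : φ.word.foldr (step T Sg m) st = table T Sg m φ :: st := by
  induction φ generalizing st with
  | or φ ψ ih₁ ih₂ | and φ ψ ih₁ ih₂ => simp [word, step, table, ih₁, ih₂]
  | ex x φ ih | all x φ ih | exInf x φ ih | allInf x φ ih =>
    rw [word, List.foldr_cons, ih]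
    rfl
  | _ => simp [word, step, table]

/-- In the structure without positions, sentences have their truth value in the empty model. -/
theorem mem_table_nil_iff (Sg : Finset (Finset A)) (m : ℕ) {e : List ℕ} (he : e ∈ envs (A := A) [] m)
    {φ : Formula A} (hφ : φ.IsSentence) : e ∈ table [] Sg m φ ↔ φ.HoldsEmpty := by
  induction φ with
  | top | bot => simp [table, HoldsEmpty, he]
  | pred a x | npred a x => simp [IsSentence, freeVars] at hφ
  | eq x y | neq x y => simp [IsSentence, freeVars] at hφ
  | or φ ψ ih₁ ih₂ | and φ ψ ih₁ ih₂ =>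
    obtain ⟨h₁, h₂⟩ := Finset.union_eq_empty.1 hφ
    simp [table, HoldsEmpty, ih₁ h₁, ih₂ h₂]
  | ex x φ ih | all x φ ih | exInf x φ ih | allInf x φ ih =>
    simp [table, HoldsEmpty, he, quantHolds]

/-- A bound for the variables occurring in a letter. -/
def letterBound : Letter A → ℕ
  | .inl _ => 0
  | .inr (.inl (_, _, x)) => x + 1
  | .inr (.inr (.inl (_, x, y))) => x + y + 1
  | .inr (.inr (.inr (_, x))) => x + 1

/-- Evaluation in a finite structure `(T, Sg)` agrees with truth in the models described by it. -/
theorem Realizes.mem_table_iff [Fintype A] {D : Type u} {V : A → Set D} {m : ℕ}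
    {T : List (Finset A)} {Sg : Finset (Finset A)} {g : ℕ → D} {e : List ℕ} (hR : Realizes V m T Sg) (φ : Formula A)
    (hφ : ∀ l ∈ φ.word, letterBound l ≤ m) (h : Agrees V T m g e) :
    e ∈ table T Sg m φ ↔ Holds V g φ := by
  induction φ generalizing g e with
  | top => simp [table, Holds, h.mem_envs]
  | bot => simp [table, Holds]
  | pred a x | npred a x =>
    have hx : x < m := hφ _ (List.mem_singleton_self _)
    have := h.2.1 x hx
    simp_all [table, Holds, h.mem_envs, mem_typeOf]
  | eq x y | neq x y =>
    have hxy : x + y + 1 ≤ m := hφ _ (List.mem_singleton_self _)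
    have := h.2.2 x (by omega) y (by omega)
    simp_all [table, Holds, h.mem_envs]
  | or φ ψ ih₁ ih₂ | and φ ψ ih₁ ih₂ =>
    simp only [word, List.forall_mem_cons, List.forall_mem_append] at hφ
    simp [table, Holds, ih₁ hφ.2.1 h, ih₂ hφ.2.2 h]
  | ex x φ ih =>
    rw [word, List.forall_mem_cons] at hφ
    have hq : ∀ d d', Matches V T m g e d d' →
        (e.set x d' ∈ table T Sg m φ ↔ Holds V (Function.update g x d) φ) :=
      fun d d' hd => ih hφ.2 (h.update hφ.1 hd)
    simp only [table, Holds, List.mem_filter, h.mem_envs, true_and, decide_eq_true_eq]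
    simp only [quantHolds]
    constructor
    · rintro ⟨d', hd', hm⟩
      obtain ⟨d, hd⟩ := hR.exists_matches_back h (List.mem_range.1 hd')
      exact ⟨d, (hq d d' hd).1 hm⟩
    · rintro ⟨d, hd⟩
      obtain ⟨d', hd'⟩ := hR.exists_matches_forth h d
      exact ⟨d', List.mem_range.2 hd'.lt, (hq d d' hd').2 hd⟩
  | all x φ ih =>
    rw [word, List.forall_mem_cons] at hφ
    have hq : ∀ d d', Matches V T m g e d d' →
        (e.set x d' ∈ table T Sg m φ ↔ Holds V (Function.update g x d) φ) :=
      fun d d' hd => ih hφ.2 (h.update hφ.1 hd)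
    simp only [table, Holds, List.mem_filter, h.mem_envs, true_and, decide_eq_true_eq]
    simp only [quantHolds]
    constructor
    · intro hall d
      obtain ⟨d', hd'⟩ := hR.exists_matches_forth h d
      exact (hq d d' hd').1 (hall d' (List.mem_range.2 hd'.lt))
    · intro hall d' hd'
      obtain ⟨d, hd⟩ := hR.exists_matches_back h (List.mem_range.1 hd')
      exact (hq d d' hd).2 (hall d)
  | exInf x φ ih =>
    rw [word, List.forall_mem_cons] at hφ
    have hq : ∀ d d', Matches V T m g e d d' →
        (e.set x d' ∈ table T Sg m φ ↔ Holds V (Function.update g x d) φ) :=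
      fun d d' hd => ih hφ.2 (h.update hφ.1 hd)
    simp only [table, Holds, List.mem_filter, h.mem_envs, true_and, decide_eq_true_eq]
    simp only [quantHolds]
    exact hR.exists_iff_infinite h hq
  | allInf x φ ih =>
    rw [word, List.forall_mem_cons] at hφ
    have hq : ∀ d d', Matches V T m g e d d' →
        (e.set x d' ∈ table T Sg m φ ↔ Holds V (Function.update g x d) φ) :=
      fun d d' hd => ih hφ.2 (h.update hφ.1 hd)
    simp only [table, Holds, List.mem_filter, h.mem_envs, true_and, decide_eq_true_eq]
    simp only [quantHolds]
    rw [← Set.not_infinite, ← hR.exists_iff_infinite h fun d d' hd => not_congr (hq d d' hd)]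
    simp only [not_exists, not_and, not_not, imp_iff_not_or]

end Tables

/-! ### The normal form of a formula -/

section NormalForm

section Realization

variable [DecidableEq A]

/-- The number of positions with type `S`. -/
def typeCount (T : List (Finset A)) (S : Finset A) : ℕ :=
  ((List.range T.length).filter fun i => T[i]? = some S).length

theorem encard_positions (T : List (Finset A)) (S : Finset A) :
    {i : ℕ | T[i]? = some S}.encard = typeCount T S := by
  have : {i : ℕ | T[i]? = some S} =
      ((Finset.range T.length).filter fun i => T[i]? = some S : Finset ℕ) := by
    ext i
    simp only [Set.mem_ofPred_eq, Finset.coe_filter, Finset.mem_range, iff_and_self]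
    exact fun h => (List.getElem?_eq_some_iff.1 h).1
  rw [this, Set.encard_coe_eq_coe_finsetCard]
  rfl

theorem mem_toFinset_of_typeCount {T : List (Finset A)} {S : Finset A} {m : ℕ}
    (h : m + 1 ≤ typeCount T S) : S ∈ T.toFinset := by
  obtain ⟨i, hi⟩ := List.exists_mem_of_length_pos (lt_of_lt_of_le m.succ_pos h)
  rw [List.mem_filter, decide_eq_true_eq] at hi
  exact List.mem_toFinset.2 (List.mem_of_getElem? hi.2)

variable [Fintype A] {D : Type u} {V : A → Set D} {m : ℕ} {T : List (Finset A)}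
  {P Sg : Finset (Finset A)} {x : ℕ → D}

theorem NablaHolds.mem_iff_infinite (h : NablaHolds V ∅ T P Sg x) (S : Finset A) :
    S ∈ Sg ↔ {d | typeOf V d = S}.Infinite := by
  obtain ⟨-, -, -, h₄, h₅⟩ := h
  simp only [satisfies_empty_iff] at h₄ h₅
  refine ⟨h₄ S, fun hinf => by_contra fun hS => hinf (h₅.subset fun d hd => ?_)⟩
  rintro ⟨S', hS', hdS'⟩
  exact hS (hd.symm.trans hdS' ▸ hS')

/-- A model with the exact types of a basic formula is described by the structure `(T, Sg)`,
provided that `T` has enough copies of the types in `P`, which may also occur outside `T`. -/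
theorem NablaHolds.realizes (h : NablaHolds V ∅ T P Sg x)
    (hP : ∀ S ∈ P ∪ Sg, m + 1 ≤ typeCount T S) : Realizes V m T Sg := by
  refine ⟨fun S => ?_, h.mem_iff_infinite⟩
  obtain ⟨h₁, h₂, h₃, -, -⟩ := h
  simp only [satisfies_empty_iff] at h₂ h₃
  have hinj : Set.InjOn x {i | T[i]? = some S} :=
    h₁.mono fun i hi => (List.getElem?_eq_some_iff.1 hi).1
  have hsub : x '' {i | T[i]? = some S} ⊆ {d | typeOf V d = S} := by
    rintro _ ⟨i, hi, rfl⟩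
    exact h₂ i S hi
  by_cases hS : S ∈ P ∪ Sg
  · have hT : (m + 1 : ℕ∞) ≤ {i : ℕ | T[i]? = some S}.encard := by
      rw [encard_positions]
      exact_mod_cast hP S hS
    rw [min_eq_left hT, min_eq_left]
    refine hT.trans ?_
    rw [← hinj.encard_image]
    exact Set.encard_le_encard hsub
  · rw [← hinj.encard_image, hsub.antisymm]
    intro d hd
    by_contra hdx
    obtain ⟨S', hS', hdS'⟩ := h₃ d fun i hi hxi =>
      hdx ⟨i, by rw [Set.mem_ofPred_eq, List.getElem?_eq_getElem hi, ← hd, ← hxi,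
        h₂ i _ (List.getElem?_eq_getElem hi)], hxi⟩
    exact hS (hd.symm.trans hdS' ▸ hS')

/-- Every model has the exact types of a basic formula with enough copies of each type in `P`. -/
theorem exists_nablaHolds [Nonempty D] (V : A → Set D) (m : ℕ) :
    ∃ (T : List (Finset A)) (P Sg : Finset (Finset A)) (x : ℕ → D),
      T.length ≤ Fintype.card (Finset A) * (m + 1) ∧ Sg ⊆ P ∧
      (∀ S ∈ P, m + 1 ≤ typeCount T S) ∧ NablaHolds V ∅ T P Sg x := by
  classical
  -- `F S` consists of `m + 1` elements of type `S`, or of all of them if there are fewer.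
  have hF : ∀ S : Finset A, ∃ F : Finset D, (F : Set D) ⊆ {d | typeOf V d = S} ∧
      F.card ≤ m + 1 ∧ (F.card = m + 1 ∨ {d | typeOf V d = S} ⊆ F) := by
    intro S
    by_cases hS : ∃ F : Finset D, (F : Set D) ⊆ {d | typeOf V d = S} ∧ F.card = m + 1
    · obtain ⟨F, hF, hc⟩ := hS
      exact ⟨F, hF, hc.le, Or.inl hc⟩
    · have hfin : {d | typeOf V d = S}.Finite := by
        by_contra hinf
        exact hS (Set.Infinite.exists_subset_card_eq hinf (m + 1))
      refine ⟨hfin.toFinset, by simp, ?_, Or.inr (by simp)⟩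
      by_contra! hlt
      obtain ⟨F, hF, hc⟩ := Finset.exists_subset_card_eq hlt.le
      exact hS ⟨F, fun d hd => by simpa using hF hd, hc⟩
  choose F hF hcard hall using hF
  let E : Finset D := Finset.univ.biUnion F
  let l : List D := E.toList
  let x : ℕ → D := fun i => l.getD i (Classical.arbitrary D)
  have hT : ∀ i S, (l.map (typeOf V))[i]? = some S ↔ ∃ h : i < l.length, typeOf V l[i] = S := by
    intro i S
    simp [List.getElem?_eq_some_iff]
  have hx : ∀ i (h : i < l.length), x i = l[i] := fun i h => by simp [x, h]
  have hE : ∀ d, d ∈ F (typeOf V d) → ∃ i < l.length, x i = d := by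
    intro d hd
    have : d ∈ l := by simpa [l, E] using ⟨_, hd⟩
    obtain ⟨i, hi, rfl⟩ := List.mem_iff_getElem.1 this
    exact ⟨i, hi, hx i hi⟩
  have hcount : ∀ S, (F S).card = m + 1 → m + 1 ≤ typeCount (l.map (typeOf V)) S := by
    intro S hS
    have : ((F S : Set D)).encard ≤ {i : ℕ | (l.map (typeOf V))[i]? = some S}.encard := by
      refine (Set.encard_le_encard (fun d hd => ?_)).trans (Set.encard_image_le x _)
      have hdS : typeOf V d = S := hF S hd
      obtain ⟨i, hi, hxi⟩ := hE d (hdS ▸ hd)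
      exact ⟨i, (hT i S).2 ⟨hi, by rw [← hx i hi, hxi, hdS]⟩, hxi⟩
    rw [encard_positions, Set.encard_coe_eq_coe_finsetCard, hS] at this
    exact_mod_cast this
  refine ⟨l.map (typeOf V), Finset.univ.filter fun S => m + 1 ≤ typeCount (l.map (typeOf V)) S,
    Finset.univ.filter fun S => {d | typeOf V d = S}.Infinite, x, ?_, ?_, by simp, ?_, ?_, ?_, ?_, ?_⟩
  · rw [List.length_map, Finset.length_toList]
    exact Finset.card_biUnion_le_card_mul _ _ _ fun S _ => hcard S
  · intro S hS
    simp only [Finset.mem_filter, Finset.mem_univ, true_and] at hS ⊢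
    refine hcount S ((hall S).resolve_right fun h => hS ((F S).finite_toSet.subset h))
  · intro i hi j hj hij
    simp only [List.length_map, Set.mem_ofPred_eq] at hi hj
    rw [hx i hi, hx j hj] at hij
    exact (List.Nodup.getElem_inj_iff E.nodup_toList).1 hij
  · intro i S hi
    obtain ⟨hi', hS⟩ := (hT i S).1 hi
    rw [satisfies_empty_iff, hx i hi', hS]
  · intro z hz
    refine ⟨typeOf V z, Finset.mem_union_left _ ?_, satisfies_empty_iff.2 rfl⟩
    simp only [Finset.mem_filter, Finset.mem_univ, true_and]
    refine hcount _ ((hall _).resolve_right fun h => ?_)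
    obtain ⟨i, hi, hxi⟩ := hE z (h rfl)
    exact hz i (by simpa using hi) hxi
  · intro S hS
    simpa [satisfies_empty_iff] using hS
  · refine ((Finset.univ.filter fun S => ¬ {d | typeOf V d = S}.Infinite).finite_toSet.biUnion
      (t := fun S => {d | typeOf V d = S}) fun S hS => ?_).subset
      fun d hd => Set.mem_biUnion (x := typeOf V d) ?_ rfl
    · simpa using hS
    · simpa [satisfies_empty_iff] using hd

/-- The truth value of a sentence is found by evaluating it in a constant environment. -/
theorem Realizes.replicate_mem_table_iff (hR : Realizes V m T Sg) {φ : Formula A}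
    (hφ : φ.IsSentence) (hm : ∀ l ∈ φ.word, letterBound l ≤ m) (g : ℕ → D) :
    List.replicate m 0 ∈ table T Sg m φ ↔ Holds V g φ := by
  obtain ⟨i, hi⟩ := (hR.exists_typeOf_eq_iff (typeOf V (g 0))).1 ⟨_, rfl⟩
  have hT : 0 < T.length := (Nat.zero_le i).trans_lt (List.getElem?_eq_some_iff.1 hi).1
  obtain ⟨d, hd⟩ := (hR.exists_typeOf_eq_iff T[0]).2 ⟨0, List.getElem?_eq_getElem hT⟩
  rw [hφ.holds_iff V g fun _ => d]
  refine hR.mem_table_iff φ hm ⟨by simp, fun y hy => ?_, fun y hy z hz => ?_⟩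
  · simp [hy, hd, hT]
  · simp [hy, hz]

end Realization

/-- A bound for the variables occurring in a word. A sum is used in place of a maximum; the bound
need not be sharp. -/
def varBound (w : List (Letter A)) : ℕ := w.foldr (fun l n => letterBound l + n) 0

theorem letterBound_le_varBound {w : List (Letter A)} {l : Letter A} (hl : l ∈ w) :
    letterBound l ≤ varBound w := by
  induction w with
  | nil => simp at hl
  | cons l' w ih =>
    rcases List.mem_cons.1 hl with rfl | hl
    · exact Nat.le_add_right _ _
    · exact (ih hl).trans (Nat.le_add_left _ _)

variable [Fintype A] [DecidableEq A]

/-- All lists of types up to a length that suffices to describe each model up to what can be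
expressed with `m` variables: `m + 1` copies of each type. -/
noncomputable def typeLists (A : Type v) [Fintype A] (m : ℕ) : List (List (Finset A)) :=
  (List.range (Fintype.card (Finset A) * (m + 1) + 1)).flatMap (tuples Finset.univ.toList)

/-- The pairs `(P, Sg)` such that `Sg ⊆ P` and no type in `Sg` meets `B`. -/
noncomputable def typePairs (B : Finset A) : List (Finset (Finset A) × Finset (Finset A)) :=
  (Finset.univ.filter fun p : Finset (Finset A) × Finset (Finset A) =>
    p.2 ⊆ p.1 ∧ B ∩ p.2.biUnion id = ∅).toList

/-- The structure `(T, p.2)` has enough positions with types in `p.1`, and the formula with the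
word `w` is true in it. -/
def Accepts (w : List (Letter A)) (p : Finset (Finset A) × Finset (Finset A))
    (T : List (Finset A)) : Prop :=
  (∀ S ∈ p.1, varBound w + 1 ≤ typeCount T S) ∧
    List.replicate (varBound w) 0 ∈ (w.foldr (step T p.2 (varBound w)) []).getD 0 []

open Classical in
/-- The disjunction of the basic formulas that describe a structure in which `φ` is true. -/
noncomputable def normalForm (C B : Finset A) (φ : Formula A) : Formula A :=
  bigOr (((typePairs B).flatMap fun p => ((typeLists A (varBound φ.word)).filter
    fun T => Accepts φ.word p T).map fun T => (T, p)).map fun t => nabla C t.1 t.2.1 t.2.2)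

open Classical in
theorem mem_normalForm_list {B : Finset A} {φ : Formula A}
    {t : List (Finset A) × Finset (Finset A) × Finset (Finset A)} :
    (t ∈ (typePairs B).flatMap fun p => ((typeLists A (varBound φ.word)).filter
      fun T => Accepts φ.word p T).map fun T => (T, p)) ↔
    (t.2.2 ⊆ t.2.1 ∧ B ∩ t.2.2.biUnion id = ∅) ∧
      t.1.length ≤ Fintype.card (Finset A) * (varBound φ.word + 1) ∧
      (∀ S ∈ t.2.1, varBound φ.word + 1 ≤ typeCount t.1 S) ∧
      List.replicate (varBound φ.word) 0 ∈ table t.1 t.2.2 (varBound φ.word) φ := by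
  obtain ⟨T, P, Sg⟩ := t
  simp only [typePairs, typeLists, List.mem_flatMap, List.mem_map, List.mem_filter, mem_tuples,
    Finset.mem_toList, Finset.mem_filter, Finset.mem_univ, true_and, List.mem_range,
    decide_eq_true_eq, Accepts, foldr_step_word, List.getD_cons_zero, Prod.exists, Prod.mk.injEq,
    Nat.lt_succ_iff]
  constructor
  · rintro ⟨P, Sg, hp, T, ⟨⟨n, hn, rfl, -⟩, h⟩, rfl, rfl, rfl⟩
    exact ⟨hp, hn, h⟩
  · rintro ⟨hp, hn, h⟩
    exact ⟨P, Sg, hp, T, ⟨⟨_, hn, rfl, by simp⟩, h⟩, rfl, rfl, rfl⟩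

theorem isNormalForm_normalForm (C B : Finset A) (φ : Formula A) :
    (normalForm C B φ).IsNormalForm C B := by
  refine ⟨_, fun t ht => ?_, rfl⟩
  obtain ⟨⟨h₁, h₂⟩, -, h₃, -⟩ := mem_normalForm_list.1 ht
  exact ⟨h₁, fun S hS => mem_toFinset_of_typeCount (h₃ S hS), h₂⟩

/-- A continuous sentence is equivalent to its normal form. -/
theorem IsContinuousIn.equivalent_normalForm {B C : Finset A} (hBC : B ⊆ C) {φ : Formula A}
    (hφ : φ.IsSentence) (hB : IsContinuousIn.{u} φ B) (hC : IsMonotoneIn.{u} φ C) :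
    Equivalent.{u} φ (normalForm C B φ) := by
  intro D V
  rcases isEmpty_or_nonempty D with hD | hD
  · rw [models_of_isEmpty, models_of_isEmpty, normalForm, holdsEmpty_bigOr_map]
    have henv : List.replicate (varBound φ.word) 0 ∈ envs (A := A) [] (varBound φ.word) :=
      mem_tuples.2 ⟨by simp, by simp +contextual [List.mem_replicate]⟩
    constructor
    · intro h
      refine ⟨([], ∅, ∅), mem_normalForm_list.2 ⟨by simp, by simp, by simp, ?_⟩, ?_⟩
      · exact (mem_table_nil_iff _ _ henv hφ).2 h
      · exact (holdsEmpty_nabla C (by simp) (by simp)).2 rfl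
    · rintro ⟨⟨T, P, Sg⟩, ht, hT⟩
      obtain ⟨⟨h₁, -⟩, -, h₃, h₄⟩ := mem_normalForm_list.1 ht
      obtain rfl := (holdsEmpty_nabla C h₁ fun S hS => mem_toFinset_of_typeCount (h₃ S hS)).1 hT
      exact (mem_table_nil_iff _ _ henv hφ).1 h₄
  · let g : ℕ → D := fun _ => Classical.arbitrary D
    rw [hφ.models_iff V g]
    simp only [Models, not_isEmpty_of_nonempty, false_and, false_or, hD, true_and, normalForm,
      holds_bigOr_map, holds_nabla, forall_const]
    constructor
    · intro h
      obtain ⟨U, hUV, hfin, hU⟩ := hB.2 D V g h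
      obtain ⟨T, P, Sg, x, hlen, hSP, hP, hx⟩ := exists_nablaHolds U (varBound φ.word)
      have hR : Realizes U (varBound φ.word) T Sg :=
        hx.realizes fun S hS => hP S (by simpa [Finset.union_eq_left.2 hSP] using hS)
      refine ⟨(T, P, Sg), mem_normalForm_list.2 ⟨⟨hSP, ?_⟩, hlen, hP, ?_⟩, x,
        hx.imp fun S d hd => (hd.of_empty C).of_bExtends (hUV.mono hBC)⟩
      · refine Finset.eq_empty_of_forall_notMem fun b hb => ?_
        rw [Finset.mem_inter, Finset.mem_biUnion] at hb
        obtain ⟨hb, S, hS, hbS⟩ := hb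
        exact ((hx.mem_iff_infinite S).1 hS) ((hfin b hb).subset fun d hd =>
          mem_typeOf.1 (hd ▸ hbS))
      · exact (hR.replicate_mem_table_iff hφ (fun l => letterBound_le_varBound) g).2 hU
    · rintro ⟨⟨T, P, Sg⟩, ht, x, hx⟩
      obtain ⟨⟨h₁, h₂⟩, -, h₃, h₄⟩ := mem_normalForm_list.1 ht
      obtain ⟨U, hUV, -, hU⟩ := hx.exists_shrink h₂
      have hR : Realizes U (varBound φ.word) T Sg :=
        hU.realizes fun S hS => h₃ S (by simpa [Finset.union_eq_left.2 h₁] using hS)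
      exact hC D U V g
        ((hR.replicate_mem_table_iff hφ (fun l => letterBound_le_varBound) g).1 h₄) hUV

theorem isContinuousIn_iff {B C : Finset A} (hBC : B ⊆ C) {φ : Formula A} (hφ : φ.IsSentence)
    (hC : IsContinuousIn.{u} φ B → IsMonotoneIn.{u} φ C) :
    IsContinuousIn.{u} φ B ↔ Equivalent.{u} φ (normalForm C B φ) :=
  ⟨fun h => h.equivalent_normalForm hBC hφ (hC h),
    fun h => (isNormalForm_normalForm C B φ).isContinuousIn hBC hφ h⟩

theorem isContinuousIn_iff_exists {B C : Finset A} (hBC : B ⊆ C) {φ : Formula A}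
    (hφ : φ.IsSentence) (hC : IsContinuousIn.{u} φ B → IsMonotoneIn.{u} φ C) :
    IsContinuousIn.{u} φ B ↔ ∃ ψ : Formula A, ψ.IsNormalForm C B ∧ Equivalent.{u} φ ψ :=
  ⟨fun h => ⟨_, isNormalForm_normalForm C B φ, h.equivalent_normalForm hBC hφ (hC h)⟩,
    fun ⟨_, hψ, h⟩ => hψ.isContinuousIn hBC hφ h⟩

end NormalForm

/-! ### Computability of the normal form -/

section Effective

section Primrec

variable {α β σ : Type*} [Primcodable α] [Primcodable β] [Primcodable σ]

theorem primrec_filter {f : α → List β} {R : β → α → Prop} [DecidableRel R] (hf : Primrec f)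
    (hR : PrimrecRel R) : Primrec fun a => (f a).filter fun b => R b a :=
  hR.listFilter.comp hf .id

theorem primrecPred_exists_mem {f : α → List β} {R : β → α → Prop} (hf : Primrec f)
    (hR : PrimrecRel R) : PrimrecPred fun a => ∃ b ∈ f a, R b a :=
  hR.exists_mem_list.comp hf .id

theorem primrecPred_forall_mem {f : α → List β} {R : β → α → Prop} (hf : Primrec f)
    (hR : PrimrecRel R) : PrimrecPred fun a => ∀ b ∈ f a, R b a :=
  hR.forall_mem_list.comp hf .id

theorem primrecRel_mem_list : PrimrecRel fun (a : α) (l : List α) => a ∈ l :=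
  ((PrimrecRel.exists_mem_list (R := fun a b : α => a = b) Primrec.eq).swap).of_eq fun a l => by
    simp

/-- A function with finitely many possible first arguments is primitive recursive if it is so for
each of them. -/
theorem primrec₂_of_finite [Finite α] {f : α → β → σ} (hf : ∀ a, Primrec (f a)) : Primrec₂ f := by
  obtain ⟨n, ⟨e⟩⟩ := Finite.exists_equiv_fin α
  have h : Primrec₂ fun (i : Fin n) b => f (e.symm i) b := Primrec.fin_curry₁.2 fun i => hf _
  refine (h.comp ((Primrec.dom_finite e).comp Primrec.fst) Primrec.snd).of_eq fun p => ?_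
  simp

theorem primrec₂_sum {γ : Type*} [Primcodable γ] {f : α → β ⊕ γ → σ}
    (hl : Primrec₂ fun a b => f a (.inl b)) (hr : Primrec₂ fun a c => f a (.inr c)) :
    Primrec₂ f := by
  refine (Primrec.sumCasesOn Primrec.snd (hl.comp (Primrec.fst.comp Primrec.fst) Primrec.snd).to₂
    (hr.comp (Primrec.fst.comp Primrec.fst) Primrec.snd).to₂).of_eq ?_
  rintro ⟨a, b | c⟩ <;> rfl

theorem primrec_flatMap_const {ι : Type*} (l : List ι) {f : ι → α → List σ}
    (hf : ∀ i, Primrec (f i)) : Primrec fun a => l.flatMap fun i => f i a := by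
  induction l with
  | nil => exact Primrec.const []
  | cons i l ih => exact Primrec.list_append.comp (hf i) ih

theorem primrec_replicate (a : α) : Primrec fun n => List.replicate n a :=
  (Primrec.list_map Primrec.list_range (Primrec.const a).to₂).of_eq fun n => by simp

theorem primrec_zipIdx (d : α) : Primrec fun l : List α => l.zipIdx := by
  refine (Primrec.list_map (f := fun l : List α => List.range l.length)
    (g := fun l i => (l.getD i d, i)) (Primrec.list_range.comp Primrec.list_length)
    (Primrec.pair (Primrec.list_getD d) Primrec.snd).to₂).of_eq fun l => ?_
  refine List.ext_getElem (by simp) fun i h₁ h₂ => ?_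
  have : i < l.length := by simpa using h₁
  simp [this]

theorem primrec_tuples : Primrec₂ (tuples : List α → ℕ → List (List α)) := by
  have hcons : Primrec₂ fun (q : (List α × ℕ × List (List α)) × List α) (a : α) => a :: q.2 :=
    Primrec.list_cons.comp Primrec.snd (Primrec.snd.comp Primrec.fst)
  have hstep : Primrec₂ fun (l : List α) (q : ℕ × List (List α)) =>
      q.2.flatMap fun t => l.map fun a => a :: t :=
    Primrec.list_flatMap (Primrec.snd.comp Primrec.snd)
      (Primrec.list_map (Primrec.fst.comp Primrec.fst) hcons)
  refine (Primrec.nat_rec (f := fun _ : List α => [[]]) (Primrec.const _) hstep).of_eq ?_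
  intro l n
  induction n with
  | zero => rfl
  | succ n ih => exact congrArg (fun t : List (List α) => t.flatMap _) ih

end Primrec

section Words

theorem word_bigAnd_map {β : Type*} (f : β → Formula A) (l : List β) :
    (bigAnd (l.map f)).word = (l.flatMap fun b => .inl 3 :: (f b).word) ++ [.inl 0] := by
  induction l with
  | nil => rfl
  | cons b l ih =>
    change Sum.inl 3 :: ((f b).word ++ (bigAnd (l.map f)).word) = _
    simp [ih]

theorem word_bigOr_map {β : Type*} (f : β → Formula A) (l : List β) :
    (bigOr (l.map f)).word = (l.flatMap fun b => .inl 2 :: (f b).word) ++ [.inl 1] := by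
  induction l with
  | nil => rfl
  | cons b l ih =>
    change Sum.inl 2 :: ((f b).word ++ (bigOr (l.map f)).word) = _
    simp [ih]

theorem word_exList (xs : List ℕ) (φ : Formula A) :
    (exList xs φ).word = (xs.map fun x => .inr (.inr (.inr (0, x)))) ++ φ.word := by
  induction xs with
  | nil => rfl
  | cons x xs ih =>
    change _ :: (exList xs φ).word = _
    simp [ih]

variable {α β : Type*} [Primcodable α] [Primcodable β] [Primcodable A]

theorem primrec_word_bigAnd_map {f : α → β → Formula A} {l : α → List β} (hl : Primrec l)
    (hf : Primrec₂ fun a b => (f a b).word) : Primrec fun a => (bigAnd ((l a).map (f a))).word := by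
  simp only [word_bigAnd_map]
  exact Primrec.list_append.comp
    (Primrec.list_flatMap hl (Primrec.list_cons.comp (Primrec.const _) hf)) (Primrec.const _)

theorem primrec_word_bigOr_map {f : α → β → Formula A} {l : α → List β} (hl : Primrec l)
    (hf : Primrec₂ fun a b => (f a b).word) : Primrec fun a => (bigOr ((l a).map (f a))).word := by
  simp only [word_bigOr_map]
  exact Primrec.list_append.comp
    (Primrec.list_flatMap hl (Primrec.list_cons.comp (Primrec.const _) hf)) (Primrec.const _)

theorem primrec_word_and {f g : α → Formula A} (hf : Primrec fun a => (f a).word)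
    (hg : Primrec fun a => (g a).word) : Primrec fun a => (and (f a) (g a)).word :=
  Primrec.list_cons.comp (Primrec.const _) (Primrec.list_append.comp hf hg)

theorem primrec_word_or {f g : α → Formula A} (hf : Primrec fun a => (f a).word)
    (hg : Primrec fun a => (g a).word) : Primrec fun a => (or (f a) (g a)).word :=
  Primrec.list_cons.comp (Primrec.const _) (Primrec.list_append.comp hf hg)

theorem primrec_word_eq_neq (b : Bool) :
    Primrec₂ fun x y : ℕ => [(.inr (.inr (.inl (b, x, y))) : Letter A)] :=
  Primrec.list_cons.comp (Primrec.sumInr.comp (Primrec.sumInr.comp (Primrec.sumInl.comp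
    (Primrec.pair (Primrec.const b) Primrec.id)))) (Primrec.const [])

theorem primrec_word_diff : Primrec fun ys : List ℕ => (diff ys : Formula A).word := by
  have h : Primrec₂ fun (_ : List ℕ) (q : ℕ × List ℕ × List (Letter A)) =>
      .inl 3 :: ((bigAnd (q.2.1.map fun y' => (neq q.1 y' : Formula A))).word ++ q.2.2) := by
    have hneq : Primrec₂ fun (q : List ℕ × ℕ × List ℕ × List (Letter A)) (y' : ℕ) =>
        (neq q.2.1 y' : Formula A).word :=
      (primrec_word_eq_neq false).comp (Primrec.fst.comp (Primrec.snd.comp Primrec.fst)) Primrec.snd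
    exact Primrec.list_cons.comp (Primrec.const _) (Primrec.list_append.comp
      (primrec_word_bigAnd_map (Primrec.fst.comp (Primrec.snd.comp Primrec.snd)) hneq)
      (Primrec.snd.comp (Primrec.snd.comp Primrec.snd)))
  refine (Primrec.list_rec Primrec.id (Primrec.const [.inl 0]) h).of_eq fun ys => ?_
  induction ys with
  | nil => rfl
  | cons y ys ih => exact congrArg (fun w => Sum.inl 3 :: (_ ++ w)) ih

theorem primrec_word_someEq : Primrec fun ys : List ℕ => (someEq ys : Formula A).word := by
  have h : Primrec₂ fun (_ : List ℕ) (q : ℕ × List ℕ × List (Letter A)) =>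
      .inl 2 :: ((bigOr (q.2.1.map fun y' => (eq q.1 y' : Formula A))).word ++ q.2.2) := by
    have heq : Primrec₂ fun (q : List ℕ × ℕ × List ℕ × List (Letter A)) (y' : ℕ) =>
        (eq q.2.1 y' : Formula A).word :=
      (primrec_word_eq_neq true).comp (Primrec.fst.comp (Primrec.snd.comp Primrec.fst)) Primrec.snd
    exact Primrec.list_cons.comp (Primrec.const _) (Primrec.list_append.comp
      (primrec_word_bigOr_map (Primrec.fst.comp (Primrec.snd.comp Primrec.snd)) heq)
      (Primrec.snd.comp (Primrec.snd.comp Primrec.snd)))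
  refine (Primrec.list_rec Primrec.id (Primrec.const [.inl 1]) h).of_eq fun ys => ?_
  induction ys with
  | nil => rfl
  | cons y ys ih => exact congrArg (fun w => Sum.inl 2 :: (_ ++ w)) ih

variable [Fintype A] [DecidableEq A]

theorem primrec_word_typ (C S : Finset A) : Primrec fun x => (typ C S x).word := by
  have hlit : ∀ (b : Bool) (l : List A), Primrec fun x =>
      (l.flatMap fun a => [(.inl 3 : Letter A), .inr (.inl (b, a, x))]) ++ [.inl 0] := by
    intro b l
    refine Primrec.list_append.comp (primrec_flatMap_const l fun a => ?_) (Primrec.const _)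
    exact Primrec.list_cons.comp (Primrec.const _) (Primrec.list_cons.comp
      (Primrec.sumInr.comp (Primrec.sumInl.comp (Primrec.pair (Primrec.const b)
        (Primrec.pair (Primrec.const a) Primrec.id)))) (Primrec.const []))
  refine primrec_word_and ?_ ?_
  · simp only [word_bigAnd_map]
    exact hlit true _
  · simp only [word_bigAnd_map]
    exact hlit false _

theorem primrec_word_someTyp (C : Finset A) (L : Finset (Finset A)) :
    Primrec fun x => (someTyp C L x).word := by
  simp only [someTyp, word_bigOr_map]
  exact Primrec.list_append.comp (primrec_flatMap_const _ fun S =>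
    Primrec.list_cons.comp (Primrec.const _) (primrec_word_typ C S)) (Primrec.const _)

/-- Types are coded by the elements of a finite initial segment of `ℕ`. Any coding would do, as every
function on a finite type is primitive recursive. -/
noncomputable local instance primcodableFinset : Primcodable (Finset A) :=
  Primcodable.ofEquiv _ (Fintype.equivFin (Finset A))

theorem primrec_word_nabla (C : Finset A) (P Sg : Finset (Finset A)) :
    Primrec fun T : List (Finset A) => (nabla C T P Sg).word := by
  have hlen : Primrec fun T : List (Finset A) => T.length := Primrec.list_length
  have hrange : Primrec fun T : List (Finset A) => List.range T.length :=
    Primrec.list_range.comp hlen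
  have htyp : Primrec₂ fun (S : Finset A) (x : ℕ) => (typ C S x).word :=
    primrec₂_of_finite (primrec_word_typ C)
  refine primrec_word_and ?_ (Primrec.const _)
  simp only [nablaFOE, word_exList]
  refine Primrec.list_append.comp (Primrec.list_map hrange ?_) ?_
  · exact Primrec.sumInr.comp (Primrec.sumInr.comp (Primrec.sumInr.comp
      (Primrec.pair (Primrec.const 0) Primrec.snd)))
  refine primrec_word_and (primrec_word_diff.comp hrange) (primrec_word_and ?_ ?_)
  · exact primrec_word_bigAnd_map (primrec_zipIdx ∅)
      (htyp.comp (Primrec.fst.comp Primrec.snd) (Primrec.snd.comp Primrec.snd))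
  · refine Primrec.list_cons.comp (Primrec.sumInr.comp (Primrec.sumInr.comp (Primrec.sumInr.comp
      (Primrec.pair (Primrec.const 1) hlen)))) (primrec_word_or ?_ ?_)
    · exact primrec_word_someEq.comp (Primrec.list_append.comp hrange
        (Primrec.list_cons.comp hlen (Primrec.const [])))
    · exact (primrec_word_someTyp C _).comp hlen

end Words

section Evaluation

attribute [local instance] primcodableFinset

theorem primrec_varBound [Primcodable A] : Primrec (varBound : List (Letter A) → ℕ) := by
  have hlb : Primrec (letterBound : Letter A → ℕ) := by
    have h₁ : Primrec fun p : Bool × A × ℕ => p.2.2 + 1 :=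
      Primrec.succ.comp (Primrec.snd.comp Primrec.snd)
    have h₂ : Primrec fun p : Bool × ℕ × ℕ => p.2.1 + p.2.2 + 1 :=
      Primrec.succ.comp (Primrec.nat_add.comp (Primrec.fst.comp Primrec.snd)
        (Primrec.snd.comp Primrec.snd))
    have h₃ : Primrec fun p : Fin 4 × ℕ => p.2 + 1 := Primrec.succ.comp Primrec.snd
    refine (Primrec.sumCasesOn Primrec.id (Primrec.const 0).to₂ (Primrec.sumCasesOn Primrec.snd
      (h₁.comp Primrec.snd).to₂ (Primrec.sumCasesOn Primrec.snd
        (h₂.comp Primrec.snd).to₂ (h₃.comp Primrec.snd).to₂).to₂).to₂).of_eq ?_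
    rintro (i | p | p | p) <;> rfl
  exact Primrec.list_foldr Primrec.id (Primrec.const 0)
    (Primrec.nat_add.comp (hlb.comp (Primrec.fst.comp Primrec.snd))
      (Primrec.snd.comp Primrec.snd)).to₂

variable [Fintype A]

theorem primrec_typeLists : Primrec (typeLists A) := by
  refine Primrec.list_flatMap (Primrec.list_range.comp (Primrec.succ.comp
    (Primrec.nat_mul.comp (Primrec.const _) Primrec.succ))) ?_
  exact primrec_tuples.comp (Primrec.const _) Primrec.snd

theorem primrec_envs : Primrec₂ (envs (A := A)) :=
  primrec_tuples.comp (Primrec.list_range.comp (Primrec.succ.comp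
    (Primrec.list_length.comp Primrec.fst))) Primrec.snd

/-- The data on which a step of the stack machine depends besides the letter read: the list of
types, the number of variables, and the stack. -/
abbrev MachineState (A : Type v) : Type v := (List (Finset A) × ℕ) × List (List (List ℕ))

theorem primrec_machineState_envs : Primrec fun q : MachineState A => envs q.1.1 q.1.2 :=
  primrec_envs.comp (Primrec.fst.comp Primrec.fst) (Primrec.snd.comp Primrec.fst)

theorem primrec_machineState_getD (k : ℕ) : Primrec fun q : MachineState A => q.2.getD k [] :=
  (Primrec.list_getD []).comp Primrec.snd (Primrec.const k)

theorem primrec_machineState_drop (k : ℕ) : Primrec fun q : MachineState A => q.2.drop k :=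
  Primrec.list_drop.comp (Primrec.const k) Primrec.snd

variable [DecidableEq A]

theorem primrec_typeCount : Primrec₂ (typeCount (A := A)) := by
  refine Primrec.list_length.comp (primrec_filter
    (R := fun i (q : List (Finset A) × Finset A) => q.1[i]? = some q.2)
    (Primrec.list_range.comp (Primrec.list_length.comp Primrec.fst)) ?_)
  exact Primrec.eq.comp (Primrec.list_getElem?.comp (Primrec.fst.comp Primrec.snd) Primrec.fst)
    (Primrec.option_some.comp (Primrec.snd.comp Primrec.snd))

theorem primrecRel_quantHolds (Sg : Finset (Finset A)) (i : Fin 4) :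
    PrimrecRel fun (e : List ℕ) (q : List (Finset A) × List (List ℕ) × ℕ) =>
      quantHolds q.1 Sg q.2.1 e q.2.2 i := by
  have hrange : Primrec fun q : List ℕ × List (Finset A) × List (List ℕ) × ℕ =>
      List.range q.2.1.length :=
    Primrec.list_range.comp (Primrec.list_length.comp (Primrec.fst.comp Primrec.snd))
  have hmem : PrimrecRel fun (d : ℕ) (q : List ℕ × List (Finset A) × List (List ℕ) × ℕ) =>
      q.1.set q.2.2.2 d ∈ q.2.2.1 := by
    refine primrecRel_mem_list.comp (Primrec.list_set.comp (Primrec.fst.comp Primrec.snd)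
      (Primrec.pair ?_ Primrec.fst)) ?_
    · exact Primrec.snd.comp (Primrec.snd.comp (Primrec.snd.comp Primrec.snd))
    · exact Primrec.fst.comp (Primrec.snd.comp (Primrec.snd.comp Primrec.snd))
  have hfresh : PrimrecRel fun (d : ℕ) (q : List ℕ × List (Finset A) × List (List ℕ) × ℕ) =>
      q.2.1.getD d ∅ ∈ Sg ∧ d ∉ q.1 := by
    refine PrimrecPred.and ?_ (PrimrecPred.not ?_)
    · exact PrimrecPred.comp (p := fun S => S ∈ Sg) (Primrec.dom_finite _).primrecPred
        ((Primrec.list_getD ∅).comp (Primrec.fst.comp (Primrec.snd.comp Primrec.snd)) Primrec.fst)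
    · exact primrecRel_mem_list.comp Primrec.fst (Primrec.fst.comp Primrec.snd)
  fin_cases i
  · exact primrecPred_exists_mem hrange hmem
  · exact primrecPred_forall_mem hrange hmem
  · exact primrecPred_exists_mem hrange (PrimrecPred.and hfresh hmem)
  · exact primrecPred_forall_mem hrange (PrimrecPred.or (PrimrecPred.not hfresh) hmem)

theorem primrec_step_inl (Sg : Finset (Finset A)) : Primrec₂ fun (q : MachineState A)
    (i : Fin 4) => step q.1.1 Sg q.1.2 (.inl i) q.2 := by
  classical
  have h : Primrec₂ fun (i : Fin 4) (q : MachineState A) =>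
      step q.1.1 Sg q.1.2 (.inl i) q.2 := by
    refine primrec₂_of_finite fun i => ?_
    fin_cases i
    · exact Primrec.list_cons.comp primrec_machineState_envs Primrec.snd
    · exact Primrec.list_cons.comp (Primrec.const []) Primrec.snd
    · exact Primrec.list_cons.comp (Primrec.list_append.comp (primrec_machineState_getD 0)
        (primrec_machineState_getD 1)) (primrec_machineState_drop 2)
    · have hR : PrimrecRel fun (e : List ℕ) (q : MachineState A) => e ∈ q.2.getD 1 [] :=
        primrecRel_mem_list.comp Primrec.fst ((primrec_machineState_getD 1).comp Primrec.snd)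
      exact Primrec.list_cons.comp (primrec_filter (primrec_machineState_getD 0) hR)
        (primrec_machineState_drop 2)
  exact h.swap

theorem primrec_step_pred [Primcodable A] (Sg : Finset (Finset A)) : Primrec₂ fun (q : MachineState A)
    (p : Bool × A × ℕ) => step q.1.1 Sg q.1.2 (.inr (.inl p)) q.2 := by
  classical
  have hmem : Primrec₂ fun (a : A) (S : Finset A) => decide (a ∈ S) := Primrec.dom_finite _
  have hR : PrimrecRel fun (e : List ℕ) (q : MachineState A × Bool × A × ℕ) =>
      decide (q.2.2.1 ∈ q.1.1.1.getD (e.getD q.2.2.2 0) ∅) = q.2.1 := by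
    refine Primrec.eq.comp (hmem.comp ?_ ((Primrec.list_getD ∅).comp ?_
      ((Primrec.list_getD 0).comp Primrec.fst ?_))) ?_
    · exact Primrec.fst.comp (Primrec.snd.comp (Primrec.snd.comp Primrec.snd))
    · exact Primrec.fst.comp (Primrec.fst.comp (Primrec.fst.comp Primrec.snd))
    · exact Primrec.snd.comp (Primrec.snd.comp (Primrec.snd.comp Primrec.snd))
    · exact Primrec.fst.comp (Primrec.snd.comp Primrec.snd)
  exact Primrec.list_cons.comp (primrec_filter (primrec_machineState_envs.comp Primrec.fst) hR)
    (Primrec.snd.comp Primrec.fst)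

theorem primrec_step_eq (Sg : Finset (Finset A)) : Primrec₂ fun (q : MachineState A)
    (p : Bool × ℕ × ℕ) => step q.1.1 Sg q.1.2 (.inr (.inr (.inl p))) q.2 := by
  classical
  have heq : Primrec₂ fun x y : ℕ => decide (x = y) := Primrec.eq.decide
  have hR : PrimrecRel fun (e : List ℕ) (q : MachineState A × Bool × ℕ × ℕ) =>
      decide (e.getD q.2.2.1 0 = e.getD q.2.2.2 0) = q.2.1 := by
    refine Primrec.eq.comp (heq.comp ((Primrec.list_getD 0).comp Primrec.fst ?_)
      ((Primrec.list_getD 0).comp Primrec.fst ?_)) ?_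
    · exact Primrec.fst.comp (Primrec.snd.comp (Primrec.snd.comp Primrec.snd))
    · exact Primrec.snd.comp (Primrec.snd.comp (Primrec.snd.comp Primrec.snd))
    · exact Primrec.fst.comp (Primrec.snd.comp Primrec.snd)
  exact Primrec.list_cons.comp (primrec_filter (primrec_machineState_envs.comp Primrec.fst) hR)
    (Primrec.snd.comp Primrec.fst)

theorem primrec_step_quant (Sg : Finset (Finset A)) : Primrec₂ fun (q : MachineState A)
    (p : Fin 4 × ℕ) => step q.1.1 Sg q.1.2 (.inr (.inr (.inr p))) q.2 := by
  classical
  have h : Primrec₂ fun (i : Fin 4) (q : MachineState A × ℕ) =>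
      step q.1.1.1 Sg q.1.1.2 (.inr (.inr (.inr (i, q.2)))) q.1.2 := by
    refine primrec₂_of_finite fun i => ?_
    have hR : PrimrecRel fun (e : List ℕ) (q : MachineState A × ℕ) =>
        quantHolds q.1.1.1 Sg (q.1.2.getD 0 []) e q.2 i := by
      refine (primrecRel_quantHolds Sg i).comp Primrec.fst (Primrec.pair ?_ (Primrec.pair ?_ ?_))
      · exact Primrec.fst.comp (Primrec.fst.comp (Primrec.fst.comp Primrec.snd))
      · exact (primrec_machineState_getD 0).comp (Primrec.fst.comp Primrec.snd)
      · exact Primrec.snd.comp Primrec.snd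
    exact Primrec.list_cons.comp (primrec_filter (primrec_machineState_envs.comp Primrec.fst) hR)
      ((primrec_machineState_drop 1).comp Primrec.fst)
  exact h.comp (Primrec.fst.comp Primrec.snd)
    (Primrec.pair Primrec.fst (Primrec.snd.comp Primrec.snd))

variable [Primcodable A]

theorem primrec_step (Sg : Finset (Finset A)) : Primrec₂ fun (q : MachineState A)
    (l : Letter A) => step q.1.1 Sg q.1.2 l q.2 :=
  primrec₂_sum (primrec_step_inl Sg) (primrec₂_sum (primrec_step_pred Sg)
    (primrec₂_sum (primrec_step_eq Sg) (primrec_step_quant Sg)))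

theorem primrecRel_accepts (p : Finset (Finset A) × Finset (Finset A)) :
    PrimrecRel fun (T : List (Finset A)) (w : List (Letter A)) => Accepts w p T := by
  have hm : Primrec fun q : List (Finset A) × List (Letter A) => varBound q.2 :=
    primrec_varBound.comp Primrec.snd
  refine PrimrecPred.and ?_ ?_
  · refine (primrecPred_forall_mem (f := fun _ : List (Finset A) × List (Letter A) => p.1.toList)
      (R := fun S q => varBound q.2 + 1 ≤ typeCount q.1 S) (Primrec.const _) ?_).of_eq ?_
    · exact Primrec.nat_le.comp (Primrec.succ.comp (hm.comp Primrec.snd))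
        (primrec_typeCount.comp (Primrec.fst.comp Primrec.snd) Primrec.fst)
    · simp
  · refine primrecRel_mem_list.comp ((primrec_replicate 0).comp hm)
      ((Primrec.list_getD []).comp ?_ (Primrec.const 0))
    have hstep : Primrec₂ fun (q : List (Finset A) × List (Letter A))
        (r : Letter A × List (List (List ℕ))) => step q.1 p.2 (varBound q.2) r.1 r.2 :=
      (primrec_step p.2).comp (Primrec.pair (Primrec.pair (Primrec.fst.comp Primrec.fst)
        (hm.comp Primrec.fst)) (Primrec.snd.comp Primrec.snd)) (Primrec.fst.comp Primrec.snd)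
    exact Primrec.list_foldr Primrec.snd (Primrec.const []) hstep

/-- The normal form is computable: its word is a concatenation of words of basic formulas, taken
over all structures that are accepted by the stack machine. -/
theorem isEffective_normalForm (C B : Finset A) : IsEffective (normalForm C B) := by
  classical
  refine ⟨fun w => ((typePairs B).flatMap fun p => ((typeLists A (varBound w)).filter
    fun T => Accepts w p T).flatMap fun T => .inl 2 :: (nabla C T p.1 p.2).word) ++ [.inl 1],
    Primrec.to_comp ?_, fun φ => ?_⟩
  · refine Primrec.list_append.comp (primrec_flatMap_const _ fun p => ?_) (Primrec.const _)
    exact Primrec.list_flatMap (primrec_filter (R := fun T w => Accepts w p T)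
      (primrec_typeLists.comp primrec_varBound) (primrecRel_accepts p))
      (Primrec.list_cons.comp (Primrec.const _) ((primrec_word_nabla C p.1 p.2).comp Primrec.snd))
  · simp only [normalForm, word_bigOr_map, List.flatMap_assoc, List.flatMap_map]

end Evaluation

end Effective

end Monadic.Formula

theorem mainTheorem9 {A : Type v} [Fintype A] [DecidableEq A] [Primcodable A] (B : Finset A) :
    ((∀ φ : Monadic.Formula A, φ.IsSentence →
        (Monadic.Formula.IsContinuousIn.{u} φ B ↔
          ∃ ψ : Monadic.Formula A, ψ.IsNormalForm B B ∧ Monadic.Formula.Equivalent.{u} φ ψ)) ∧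
      ∃ f : Monadic.Formula A → Monadic.Formula A, Monadic.IsEffective f ∧
        ∀ φ : Monadic.Formula A, φ.IsSentence →
          (f φ).IsNormalForm B B ∧
          (Monadic.Formula.IsContinuousIn.{u} φ B ↔ Monadic.Formula.Equivalent.{u} φ (f φ))) ∧
    ((∀ φ : Monadic.Formula A, φ.IsSentence →
        (Monadic.Formula.IsMonotoneIn.{u} φ Finset.univ ∨ φ.IsPositive) →
        (Monadic.Formula.IsContinuousIn.{u} φ B ↔
          ∃ ψ : Monadic.Formula A,
            ψ.IsNormalForm Finset.univ B ∧ Monadic.Formula.Equivalent.{u} φ ψ)) ∧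
      ∃ f : Monadic.Formula A → Monadic.Formula A, Monadic.IsEffective f ∧
        ∀ φ : Monadic.Formula A, φ.IsSentence →
          (Monadic.Formula.IsMonotoneIn.{u} φ Finset.univ ∨ φ.IsPositive) →
          (f φ).IsNormalForm Finset.univ B ∧
          (Monadic.Formula.IsContinuousIn.{u} φ B ↔
            Monadic.Formula.Equivalent.{u} φ (f φ))) := by
  refine ⟨⟨fun φ hφ => ?_, Monadic.Formula.normalForm B B,
    Monadic.Formula.isEffective_normalForm B B, fun φ hφ => ⟨?_, ?_⟩⟩,
    fun φ hφ hpos => ?_, Monadic.Formula.normalForm Finset.univ B,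
    Monadic.Formula.isEffective_normalForm Finset.univ B, fun φ hφ hpos => ⟨?_, ?_⟩⟩
  · exact Monadic.Formula.isContinuousIn_iff_exists subset_rfl hφ And.left
  · exact Monadic.Formula.isNormalForm_normalForm B B φ
  · exact Monadic.Formula.isContinuousIn_iff subset_rfl hφ And.left
  · exact Monadic.Formula.isContinuousIn_iff_exists (Finset.subset_univ B) hφ fun _ =>
      hpos.elim id Monadic.Formula.IsPositive.isMonotoneIn
  · exact Monadic.Formula.isNormalForm_normalForm Finset.univ B φ
  · exact Monadic.Formula.isContinuousIn_iff (Finset.subset_univ B) hφ fun _ =>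
      hpos.elim id Monadic.Formula.IsPositive.isMonotoneIn
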